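/- Let $\mathcal X$ be a finite nonempty set (for instance a finite subset of $\mathbb R^d$) and let $f\sim\mathcal{GP}(0,k)$ be a centred Gaussian process on $\mathcal X$ whose covariance kernel $k$ (for instance a stationary one) satisfies $k(x,x)=1$ for all $x\in\mathcal X$. Let $\epsilon_1,\epsilon_2,\dots$ be i.i.d. $\mathcal N(0,\sigma^2)$ with $\sigma^2>0$, and let $\zeta_1,\zeta_2,\dots$ be i.i.d. with the two-parameter exponential distribution with parameters $s=2\log(|\mathcal X|/2)$ and $\lambda=1/2$, that is, $\zeta_t$ is distributed as $s+Z$ with $Z$ exponential of rate $\lambda$; in particular these parameters do not depend on $t$. The function $f$, the noise $(\epsilon_t)_t$ and $(\zeta_t)_t$ are independent. At each round $t=1,2,\dots$, given $\mathcal D_{t-1}=\{(x_i,y_i)\}_{i=1}^{t-1}$, the algorithm IRGP-UCB queries $$x_t\in\operatorname*{argmax}_{x\in\mathcal X}\ \mu_{t-1}(x)+\zeta_t^{1/2}\sigma_{t-1}(x)$$ and observes $y_t=f(x_t)+\epsilon_t$. Here $\mu_{t-1}(x)=\mathbf k_{t-1}(x)^\top(\mathbf K+\sigma^2\mathbf I)^{-1}\mathbf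 y_{t-1}$ and $\sigma_{t-1}^2(x)=k(x,x)-\mathbf k_{t-1}(x)^\top(\mathbf K+\sigma^2\mathbf I)^{-1}\mathbf k_{t-1}(x)$, with $\mathbf k_{t-1}(x)=(k(x,x_i))_{i<t}$, $\mathbf K=(k(x_i,x_j))_{i,j<t}$ and $\mathbf y_{t-1}=(y_i)_{i<t}$, are the posterior mean and variance. Ties in the argmax are broken by an arbitrary measurable rule that uses only $\mathcal D_{t-1}$, $\zeta_t$ and possibly a random variable $U$ independent of $(f,(\epsilon_t)_t,(\zeta_t)_t)$. (If $|\mathcal X|=1$, where $\zeta_t$ may be negative, read $\zeta_t^{1/2}$ as $0$ for $\zeta_t<0$.) Let $\gamma_T$ be the maximum information gain, i.e. the maximum over all $(a_1,\dots,a_T)\in\mathcal X^T$ (repetitions allowed) of the Shannon mutual information between $(f(a_i)+\epsilon_i)_{i=1}^T$ and $(f(a_i))_{i=1}^T$. Then for every $T\ge 0$, $\gamma_T$ is finite, the cumulative regret $\sum_{t=1}^T\bigl(\max_{x\in\mathcal X}f(x)-f(x_t)\bigr)$ is integrable, and the Bayesian cumulative regret satisfies $$\mathrm{BCR}_T:=\mathbb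 E\Bigl[\sum_{t=1}^T\bigl(\max_{x\in\mathcal X}f(x)-f(x_t)\bigr)\Bigr]\le\sqrt{C_1C_2T\gamma_T},\qquad C_1=\frac{2}{\log(1+\sigma^{-2})},\quad C_2=2+s .$$ Since $C_1$ and $C_2$ do not depend on $T$, this is an $O(\sqrt{T\gamma_T})$ bound. -/

import Mathlib

open MeasureTheory ProbabilityTheory InformationTheory
open scoped NNReal ENNReal Matrix

noncomputable section

/-- `f` is a centred Gaussian process with covariance kernel `k`, i.e. `f ∼ GP(0, k)`. -/
structure IsCenteredGP {Ω 𝒳 : Type*} [MeasurableSpace Ω] (P : Measure Ω)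
    (k : 𝒳 → 𝒳 → ℝ) (f : 𝒳 → Ω → ℝ) : Prop where
  measurable : ∀ x, Measurable (f x)
  gaussian : IsGaussianProcess f P
  mean_zero : ∀ x, ∫ ω, f x ω ∂P = 0
  cov_eq : ∀ x x', covariance (f x) (f x') P = k x x'

/-- The two-parameter exponential distribution with location `s` and rate `l`:
the law of `s + Z` with `Z ∼ Exp(l)`. -/
def twoParamExpMeasure (s l : ℝ) : Measure ℝ :=
  (expMeasure l).map (fun z => s + z)

section Posterior

variable {𝒳 : Type*}

/-- The regularised kernel matrix `K + v I` at the query points `a`. -/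
def regKernelMatrix (k : 𝒳 → 𝒳 → ℝ) (v : ℝ) {t : ℕ} (a : Fin t → 𝒳) :
    Matrix (Fin t) (Fin t) ℝ :=
  Matrix.of (fun i j => k (a i) (a j)) + v • (1 : Matrix (Fin t) (Fin t) ℝ)

/-- The vector `(k(x, a₁), …, k(x, a_t))`. -/
def kernelVec (k : 𝒳 → 𝒳 → ℝ) {t : ℕ} (a : Fin t → 𝒳) (x : 𝒳) : Fin t → ℝ :=
  fun i => k x (a i)

/-- GP posterior mean at `x` after observing `D = ((a₁, y₁), …, (a_t, y_t))`, noise variance `v`. -/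
def postMean (k : 𝒳 → 𝒳 → ℝ) (v : ℝ) {t : ℕ} (D : Fin t → 𝒳 × ℝ) (x : 𝒳) : ℝ :=
  kernelVec k (fun i => (D i).1) x ⬝ᵥ
    ((regKernelMatrix k v (fun i => (D i).1))⁻¹ *ᵥ (fun i => (D i).2))

/-- GP posterior variance at `x` after observing `D`, noise variance `v`. -/
def postVar (k : 𝒳 → 𝒳 → ℝ) (v : ℝ) {t : ℕ} (D : Fin t → 𝒳 × ℝ) (x : 𝒳) : ℝ :=
  k x x - kernelVec k (fun i => (D i).1) x ⬝ᵥ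
    ((regKernelMatrix k v (fun i => (D i).1))⁻¹ *ᵥ kernelVec k (fun i => (D i).1) x)

/-- The acquisition function `μ(x) + z^{1/2} σ(x)` computed from the data `D`. -/
def ucb (k : 𝒳 → 𝒳 → ℝ) (v : ℝ) {t : ℕ} (D : Fin t → 𝒳 × ℝ) (z : ℝ) (x : 𝒳) : ℝ :=
  postMean k v D x + √z * √(postVar k v D x)

end Posterior

/-- The data available after `t` rounds: queried points `x 0, …, x (t-1)`, together with the noisy
observations `f (x i) + ε i`. -/
def dataset {Ω 𝒳 : Type*} (f : 𝒳 → Ω → ℝ) (ε : ℕ → Ω → ℝ) (x : ℕ → Ω → 𝒳) (t : ℕ) (ω : Ω) :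
    Fin t → 𝒳 × ℝ :=
  fun i => (x i ω, f (x i ω) ω + ε i ω)

/-- `x` is a sequence of queries made by randomised GP-UCB with confidence parameters `ζ`: at each
round the query maximises the acquisition function, and it is computed by a measurable rule from the
current data, the current confidence parameter and a variable `U` used to break ties.
Rounds are numbered from `0`. -/
structure IsRandomizedGPUCB {Ω 𝒳 𝒰 : Type*} [MeasurableSpace 𝒳] [MeasurableSpace 𝒰]
    (k : 𝒳 → 𝒳 → ℝ) (v : ℝ) (f : 𝒳 → Ω → ℝ) (ε ζ : ℕ → Ω → ℝ) (U : Ω → 𝒰)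
    (x : ℕ → Ω → 𝒳) : Prop where
  rule : ∃ g : ∀ t : ℕ, 𝒰 × (Fin t → 𝒳 × ℝ) × ℝ → 𝒳, (∀ t, Measurable (g t)) ∧
    ∀ t ω, x t ω = g t (U ω, dataset f ε x t ω, ζ t ω)
  argmax : ∀ t ω x', ucb k v (dataset f ε x t ω) (ζ t ω) x' ≤
    ucb k v (dataset f ε x t ω) (ζ t ω) (x t ω)

/-- Shannon mutual information `I(X ; Y)`: the Kullback–Leibler divergence of the joint law from the
product of the marginal laws. -/
def mutualInfo {Ω α β : Type*} [MeasurableSpace Ω] [MeasurableSpace α] [MeasurableSpace β]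
    (P : Measure Ω) (X : Ω → α) (Y : Ω → β) : ℝ≥0∞ :=
  klDiv (P.map (fun ω => (X ω, Y ω))) ((P.map X).prod (P.map Y))

/-- Maximum information gain `γ_T`: the maximum of `I(y_A ; f_A)` over all choices
`A = (a₁, …, a_T)` of `T` points (repetitions allowed), where `y_A = f_A + ε_A`. -/
def maxInfoGain {Ω 𝒳 : Type*} [MeasurableSpace Ω] (P : Measure Ω) (f : 𝒳 → Ω → ℝ)
    (ε : ℕ → Ω → ℝ) (T : ℕ) : ℝ≥0∞ :=
  ⨆ a : Fin T → 𝒳, mutualInfo P (fun ω (i : Fin T) => f (a i) ω + ε i ω)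
    (fun ω (i : Fin T) => f (a i) ω)

/-- The cumulative regret `∑_{t ≤ T} (f(x*) - f(x_t))`, where `f(x*) = max_x f(x)`. -/
def cumRegret {Ω 𝒳 : Type*} (f : 𝒳 → Ω → ℝ) (x : ℕ → Ω → 𝒳) (T : ℕ) (ω : Ω) : ℝ :=
  ∑ t ∈ Finset.range T, ((⨆ x', f x' ω) - f (x t ω) ω)

/-- Bayesian cumulative regret: expectation over all the randomness. -/
def bayesCumRegret {Ω 𝒳 : Type*} [MeasurableSpace Ω] (P : Measure Ω) (f : 𝒳 → Ω → ℝ)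
    (x : ℕ → Ω → 𝒳) (T : ℕ) : ℝ :=
  ∫ ω, cumRegret f x T ω ∂P

end

/-!
The proof compares each round with the posterior law of `f` given the data, but never constructs
that law. For *fixed* query points `a`, write `y` for the noisy observations at `a`. By joint
Gaussianity the error `f - postMean a y` is independent of `y`, being uncorrelated with it, and has
variance `designVar a` (the posterior variance). The queries are adaptive, but the event that the
first `t` queries are `a` is determined by the observations at the fixed points `a`, by `ζ` and by
`U` (`firstQueries_eq_iff`). Splitting an expectation over the finitely many values of the first
queries therefore reduces every conditional statement to a fixed design and an independence
(`IsExogenous.indepFun_past`, `IsExogenous.indepFun_postResid`).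

Three facts are combined.

* For centred Gaussians `R x` of variance `v x`, the maximum of `m x + R x` is stochastically
  dominated by the maximum of `m x + √ζ √(v x)` when `ζ` has the two-parameter exponential law: the
  union bound over `𝒳` with the sharp Gaussian tail `exp (-z / 2) / 2` produces exactly the tail of
  `ζ` (`integral_max_gaussian_le_integral_ucb`). Applied to the posterior, the expected maximum of
  `f` is at most the expected maximum of the acquisition function, which is its value at the query.
* The posterior mean is unbiased at the query, so that the expected regret of round `t` is at most
  the expectation of `√ζ_t` times the posterior standard deviation at the query
  (`IsGPRegression.integral_regret_le`).
* Along any sequence of points, the mutual information between the noisy and the noiseless values is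
  `∑ t, log (1 + v⁻¹ * designVar) / 2` (`IsGPRegression.mutualInfo_eq`): the observations form an
  autoregressive Gaussian sequence, whose density is a product over the rounds, and so is their
  density given `f`. Hence the posterior variances met along the way add up to at most `C₁ γ_T`
  (`IsGPRegression.sum_designVar_le`), for every outcome.

The Cauchy–Schwarz inequality over the rounds and `𝔼 √(∑ ζ_t) ≤ √(∑ 𝔼 ζ_t) = √(T (2 + s))` give the
bound. The comparison of maxima needs `s ≥ 0`, that is, at least two points; with one point there
is no regret.
-/

/-! ### Independence of regrouped families -/

section Indep

variable {Ω α β γ δ : Type*} [MeasurableSpace Ω] {P : Measure Ω} [IsProbabilityMeasure P]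
  [MeasurableSpace α] [MeasurableSpace β] [MeasurableSpace γ] [MeasurableSpace δ]
  {X : Ω → α} {Y : Ω → β} {Z : Ω → γ} {W : Ω → δ}

lemma indepFun_prodMk_right_of_prodMk_left (hX : Measurable X) (hY : Measurable Y)
    (hZ : Measurable Z) (hXY : IndepFun X Y P) (hXYZ : IndepFun (fun ω => (X ω, Y ω)) Z P) :
    IndepFun X (fun ω => (Y ω, Z ω)) P := by
  have hYZ : IndepFun Y Z P := hXYZ.comp measurable_snd measurable_id
  have := Measure.isProbabilityMeasure_map (μ := P) hX.aemeasurable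
  have := Measure.isProbabilityMeasure_map (μ := P) hY.aemeasurable
  have := Measure.isProbabilityMeasure_map (μ := P) hZ.aemeasurable
  rw [indepFun_iff_map_prod_eq_prod_map_map hX.aemeasurable (hY.prodMk hZ).aemeasurable,
    (indepFun_iff_map_prod_eq_prod_map_map hY.aemeasurable hZ.aemeasurable).1 hYZ,
    ← Measure.prodAssoc_prod,
    ← (indepFun_iff_map_prod_eq_prod_map_map hX.aemeasurable hY.aemeasurable).1 hXY,
    ← (indepFun_iff_map_prod_eq_prod_map_map (hX.prodMk hY).aemeasurable hZ.aemeasurable).1 hXYZ,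
    Measure.map_map MeasurableEquiv.prodAssoc.measurable ((hX.prodMk hY).prodMk hZ)]
  rfl

lemma indepFun_prodMk_left_of_prodMk_right (hX : Measurable X) (hY : Measurable Y)
    (hZ : Measurable Z) (hYZ : IndepFun Y Z P) (hXYZ : IndepFun X (fun ω => (Y ω, Z ω)) P) :
    IndepFun (fun ω => (X ω, Y ω)) Z P := by
  have h : IndepFun (fun ω => (Z ω, Y ω)) X P :=
    hXYZ.symm.comp measurable_swap measurable_id
  exact (indepFun_prodMk_right_of_prodMk_left hZ hY hX hYZ.symm h).symm.comp
    measurable_swap measurable_id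

/-- Two independent pairs with independent components can be regrouped componentwise. -/
lemma indepFun_prodMk_prodMk_comm (hX : Measurable X) (hY : Measurable Y)
    (hZ : Measurable Z) (hW : Measurable W) (hXY : IndepFun X Y P) (hZW : IndepFun Z W P)
    (h : IndepFun (fun ω => (X ω, Y ω)) (fun ω => (Z ω, W ω)) P) :
    IndepFun (fun ω => (X ω, Z ω)) (fun ω => (Y ω, W ω)) P := by
  have hY' : IndepFun Y (fun ω => (W ω, Z ω)) P :=
    h.comp measurable_snd measurable_swap
  have hZ' : IndepFun Z (fun ω => (Y ω, W ω)) P :=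
    (indepFun_prodMk_left_of_prodMk_right hY hW hZ hZW.symm hY').symm
  have hX' : IndepFun X (fun ω => (Z ω, (Y ω, W ω))) P :=
    (indepFun_prodMk_right_of_prodMk_left hX hY (hZ.prodMk hW) hXY h).comp measurable_id
      (show Measurable fun p : β × γ × δ => (p.2.1, (p.1, p.2.2)) by fun_prop)
  exact indepFun_prodMk_left_of_prodMk_right hX hZ (hY.prodMk hW) hZ' hX'

end Indep

/-! ### Tails of the Gaussian and of the two-parameter exponential distribution -/

lemma gaussianReal_Ioi_zero_le_half (v : ℝ≥0) :
    gaussianReal 0 v (Set.Ioi 0) ≤ 2⁻¹ := by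
  have hsymm : gaussianReal 0 v (Set.Iio 0) = gaussianReal 0 v (Set.Ioi 0) := by
    conv_lhs => rw [← neg_zero (G := ℝ), ← gaussianReal_map_neg (μ := 0) (v := v),
      Measure.map_apply measurable_neg measurableSet_Iio]
    congr 1
    ext x
    simp
  have hdisj : Disjoint (Set.Ioi (0 : ℝ)) (Set.Iio 0) :=
    Set.disjoint_left.2 fun x (hx : 0 < x) (hx' : x < 0) => lt_asymm hx hx'
  have hsum : gaussianReal 0 v (Set.Ioi 0) + gaussianReal 0 v (Set.Ioi 0) ≤ 1 := by
    nth_rewrite 2 [← hsymm]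
    rw [← measure_union hdisj measurableSet_Iio]
    exact prob_le_one
  rw [← mul_two] at hsum
  rw [← one_div]
  exact (ENNReal.le_div_iff_mul_le (by simp) (by simp)).2 hsum

/-- The Gaussian tail bound with the sharp constant `1 / 2`. -/
lemma gaussianReal_Ioi_le {v : ℝ≥0} (hv : v ≠ 0) {c : ℝ} (hc : 0 ≤ c) :
    gaussianReal 0 v (Set.Ioi c) ≤ ENNReal.ofReal (Real.exp (-c ^ 2 / (2 * v))) * 2⁻¹ := by
  have hshift : gaussianReal 0 v (Set.Ioi c) =
      ∫⁻ u in Set.Ioi 0, gaussianPDF 0 v (u + c) := by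
    rw [gaussianReal_apply _ hv, ← lintegral_indicator measurableSet_Ioi,
      ← lintegral_indicator measurableSet_Ioi,
      ← lintegral_add_right_eq_self (fun x => Set.indicator (Set.Ioi c) _ x) c]
    congr with u
    simp [Set.indicator_apply]
  rw [hshift]
  calc ∫⁻ u in Set.Ioi 0, gaussianPDF 0 v (u + c)
      ≤ ∫⁻ u in Set.Ioi 0, ENNReal.ofReal (Real.exp (-c ^ 2 / (2 * v))) * gaussianPDF 0 v u := by
        refine setLIntegral_mono (by fun_prop) fun u hu => ?_
        rw [gaussianPDF, gaussianPDF, ← ENNReal.ofReal_mul (Real.exp_nonneg _)]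
        refine ENNReal.ofReal_le_ofReal ?_
        rw [gaussianPDFReal, gaussianPDFReal, mul_left_comm, ← Real.exp_add]
        gcongr
        rw [← add_div]
        have hu' : (0 : ℝ) < u := hu
        gcongr
        nlinarith
    _ = ENNReal.ofReal (Real.exp (-c ^ 2 / (2 * v))) * gaussianReal 0 v (Set.Ioi 0) := by
        rw [lintegral_const_mul _ (by fun_prop), gaussianReal_apply _ hv]
    _ ≤ _ := by gcongr; exact gaussianReal_Ioi_zero_le_half v

/-- A centred Gaussian exceeds `√z` standard deviations with probability at most `exp (-z/2) / 2`;
degenerate Gaussians are included. -/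
lemma gaussianReal_Ioi_sqrt_le (v : ℝ≥0) {z : ℝ} (hz : 0 ≤ z) :
    gaussianReal 0 v (Set.Ioi (√z * √v)) ≤ ENNReal.ofReal (Real.exp (-z / 2)) * 2⁻¹ := by
  rcases eq_or_ne v 0 with rfl | hv
  · simp
  · refine (gaussianReal_Ioi_le hv (by positivity)).trans_eq ?_
    have : (v : ℝ) ≠ 0 := by exact_mod_cast hv
    rw [mul_pow, Real.sq_sqrt hz, Real.sq_sqrt (NNReal.coe_nonneg v)]
    congr 3
    field_simp

lemma isProbabilityMeasure_twoParamExpMeasure (s : ℝ) {l : ℝ} (hl : 0 < l) :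
    IsProbabilityMeasure (twoParamExpMeasure s l) := by
  have := isProbabilityMeasure_expMeasure hl
  exact Measure.isProbabilityMeasure_map (by fun_prop)

lemma expMeasure_Ioi {l : ℝ} (hl : 0 < l) {z : ℝ} (hz : 0 ≤ z) :
    expMeasure l (Set.Ioi z) = ENNReal.ofReal (Real.exp (-(l * z))) := by
  have := isProbabilityMeasure_expMeasure hl
  have h := cdf_expMeasure_eq hl z
  rw [if_pos hz, cdf_eq_real] at h
  rw [← Set.compl_Iic, ← ofReal_measureReal, probReal_compl_eq_one_sub measurableSet_Iic, h]
  congr 1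
  ring

lemma twoParamExpMeasure_Ioi {s l : ℝ} (hl : 0 < l) {z : ℝ} (hz : s ≤ z) :
    twoParamExpMeasure s l (Set.Ioi z) = ENNReal.ofReal (Real.exp (-(l * (z - s)))) := by
  rw [twoParamExpMeasure, Measure.map_apply (by fun_prop) measurableSet_Ioi,
    ← expMeasure_Ioi hl (sub_nonneg.2 hz)]
  congr 1
  ext x
  simp [sub_lt_iff_lt_add']

lemma ae_le_twoParamExpMeasure (s : ℝ) {l : ℝ} (hl : 0 < l) :
    ∀ᵐ z ∂twoParamExpMeasure s l, s ≤ z := by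
  have := isProbabilityMeasure_twoParamExpMeasure s hl
  have h := twoParamExpMeasure_Ioi hl (le_refl s)
  have h1 : Set.Ioi s ∈ ae (twoParamExpMeasure s l) := by
    rw [mem_ae_iff_prob_eq_one measurableSet_Ioi, h]
    simp
  filter_upwards [h1] with z hz using le_of_lt hz

lemma lintegral_expMeasure {l : ℝ} (hl : 0 < l) :
    ∫⁻ z, ENNReal.ofReal z ∂expMeasure l = ENNReal.ofReal l⁻¹ := by
  have hpos : 0 ≤ᵐ[expMeasure l] (fun z : ℝ => z) := by
    have h := ae_le_twoParamExpMeasure 0 hl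
    rwa [twoParamExpMeasure, show (fun z : ℝ => 0 + z) = id by ext; simp, Measure.map_id] at h
  have hint : IntegrableOn (fun t : ℝ => Real.exp (-l * t)) (Set.Ioi 0) :=
    exp_neg_integrableOn_Ioi 0 hl
  rw [lintegral_eq_lintegral_meas_lt _ hpos (by fun_prop)]
  calc ∫⁻ t in Set.Ioi 0, expMeasure l {a | t < a}
      = ∫⁻ t in Set.Ioi 0, ENNReal.ofReal (Real.exp (-l * t)) := by
        refine setLIntegral_congr_fun measurableSet_Ioi fun t ht => ?_
        rw [neg_mul]
        exact expMeasure_Ioi hl (le_of_lt ht)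
    _ = ENNReal.ofReal l⁻¹ := by
        rw [← ofReal_integral_eq_lintegral_ofReal hint (ae_of_all _ fun _ => Real.exp_nonneg _),
          integral_exp_mul_Ioi (by linarith)]
        congr 1
        simp

lemma integrable_id_twoParamExpMeasure (s : ℝ) {l : ℝ} (hl : 0 < l) :
    Integrable (fun z : ℝ => z) (twoParamExpMeasure s l) ∧
      ∫ z, z ∂twoParamExpMeasure s l = s + l⁻¹ := by
  have := isProbabilityMeasure_expMeasure hl
  have hpos : 0 ≤ᵐ[expMeasure l] (fun z : ℝ => z) := by
    have h := ae_le_twoParamExpMeasure 0 hl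
    rwa [twoParamExpMeasure, show (fun z : ℝ => 0 + z) = id by ext; simp, Measure.map_id] at h
  have hint : Integrable (fun z : ℝ => z) (expMeasure l) := by
    rw [← lintegral_ofReal_ne_top_iff_integrable (by fun_prop) hpos, lintegral_expMeasure hl]
    simp
  refine ⟨?_, ?_⟩
  · rw [twoParamExpMeasure, integrable_map_measure (by fun_prop) (by fun_prop)]
    exact (integrable_const s).add hint
  · rw [twoParamExpMeasure, integral_map (by fun_prop) (by fun_prop),
      integral_add (integrable_const s) hint, integral_eq_lintegral_of_nonneg_ae hpos (by fun_prop),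
      lintegral_expMeasure hl, ENNReal.toReal_ofReal (by positivity)]
    simp

/-! ### Comparing an expected maximum with the expected upper confidence bound -/

lemma integrable_ciSup_of_fintype {Ω ι : Type*} [MeasurableSpace Ω] {μ : Measure Ω} [Fintype ι]
    [Nonempty ι] {g : ι → Ω → ℝ} (hg : ∀ i, Integrable (g i) μ) :
    Integrable (fun ω => ⨆ i, g i ω) μ := by
  have h : Integrable (Finset.univ.sup' Finset.univ_nonempty g) μ :=
    Finset.sup'_induction (p := fun u => Integrable u μ) _ _
      (fun _ h₁ _ h₂ => Integrable.sup h₁ h₂) fun i _ => hg i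
  refine h.congr (ae_of_all _ fun ω => ?_)
  simp only [Finset.sup'_apply]
  exact Finset.sup'_univ_eq_ciSup fun i => g i ω

/-- First-order stochastic dominance implies domination of the means. The tails only have to be
compared above an almost sure lower bound of the dominating variable. -/
lemma integral_le_integral_of_tail_le {Ω Ω' : Type*} [MeasurableSpace Ω] [MeasurableSpace Ω']
    {μ : Measure Ω} {ν : Measure Ω'} [IsProbabilityMeasure μ] [IsProbabilityMeasure ν]
    {X : Ω → ℝ} {Y : Ω' → ℝ} (hX : Integrable X μ) (hY : Integrable Y ν) (c : ℝ)
    (hc : ∀ᵐ ω ∂ν, c ≤ Y ω) (h : ∀ M, c ≤ M → μ {ω | M < X ω} ≤ ν {ω | M < Y ω}) :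
    ∫ ω, X ω ∂μ ≤ ∫ ω, Y ω ∂ν := by
  have hXc : Integrable (fun ω => max (X ω - c) 0) μ := (hX.sub (integrable_const c)).pos_part
  have hYc : Integrable (fun ω => Y ω - c) ν := hY.sub (integrable_const c)
  have hYnn : 0 ≤ᵐ[ν] fun ω => Y ω - c := by
    filter_upwards [hc] with ω hω using sub_nonneg.2 hω
  have hXnn : 0 ≤ᵐ[μ] fun ω => max (X ω - c) 0 := ae_of_all _ fun ω => le_max_right _ _
  have key : ∫ ω, max (X ω - c) 0 ∂μ ≤ ∫ ω, (Y ω - c) ∂ν := by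
    rw [← ENNReal.ofReal_le_ofReal_iff (integral_nonneg_of_ae hYnn),
      ofReal_integral_eq_lintegral_ofReal hXc hXnn, ofReal_integral_eq_lintegral_ofReal hYc hYnn,
      lintegral_eq_lintegral_meas_lt _ hXnn hXc.aemeasurable,
      lintegral_eq_lintegral_meas_lt _ hYnn hYc.aemeasurable]
    refine setLIntegral_mono' measurableSet_Ioi fun t ht => ?_
    have ht : 0 < t := ht
    convert h (c + t) (by linarith) using 3
    · ext ω
      simp only [lt_max_iff, lt_sub_iff_add_lt', or_iff_left ht.not_gt]
    · ext ω
      simp only [lt_sub_iff_add_lt']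
  have h1 : ∫ ω, X ω ∂μ ≤ ∫ ω, (max (X ω - c) 0 + c) ∂μ := by
    refine integral_mono hX (hXc.add (integrable_const c)) fun ω => ?_
    have := le_max_left (X ω - c) 0
    simp only
    linarith
  rw [integral_add hXc (integrable_const c)] at h1
  rw [integral_sub hY (integrable_const c)] at key
  simp only [integral_const, probReal_univ, one_smul] at h1 key
  linarith

lemma integrable_sqrt_of_integrable {Ω : Type*} [MeasurableSpace Ω] {μ : Measure Ω}
    [IsProbabilityMeasure μ] {Z : Ω → ℝ} (hZ : Integrable Z μ) :
    Integrable (fun ω => √(Z ω)) μ := by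
  refine ((integrable_const (1 : ℝ)).add hZ.abs).mono'
    (Real.continuous_sqrt.comp_aestronglyMeasurable hZ.1) (ae_of_all _ fun ω => ?_)
  rw [Real.norm_of_nonneg (Real.sqrt_nonneg _)]
  have h1 := le_abs_self (Z ω)
  have h2 := abs_nonneg (Z ω)
  simp only [Pi.add_apply]
  exact Real.sqrt_le_iff.2 ⟨by positivity, by nlinarith⟩

/-- The expected maximum of Gaussian variables `m x + R x`, of variance `v x` and arbitrary
dependence, is at most the expected maximum of the upper confidence bounds `m x + √z √(v x)` when
the confidence parameter `z` follows the two-parameter exponential law. For a fixed `z`, a union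
bound shows that the first maximum exceeds the second with probability at most
`|𝒳| / 2 * exp (-z / 2)`, which is the tail of the law of `z`: the second maximum stochastically
dominates the first. -/
lemma integral_max_gaussian_le_integral_ucb {Ω 𝒳 : Type*} [MeasurableSpace Ω] {μ : Measure Ω}
    [IsProbabilityMeasure μ] [Fintype 𝒳] [Nonempty 𝒳] (hcard : 2 ≤ Fintype.card 𝒳)
    (m : 𝒳 → ℝ) (v : 𝒳 → ℝ≥0) (R : 𝒳 → Ω → ℝ) (hRm : ∀ x, Measurable (R x))
    (hR : ∀ x, μ.map (R x) = gaussianReal 0 (v x)) :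
    ∫ ω, (⨆ x, (m x + R x ω)) ∂μ ≤
      ∫ z, (⨆ x, (m x + √z * √(v x)))
        ∂twoParamExpMeasure (2 * Real.log ((Fintype.card 𝒳 : ℝ) / 2)) (1 / 2) := by
  set s : ℝ := 2 * Real.log ((Fintype.card 𝒳 : ℝ) / 2) with hs
  have hn : (2 : ℝ) ≤ Fintype.card 𝒳 := by exact_mod_cast hcard
  have hs0 : 0 ≤ s := mul_nonneg zero_le_two (Real.log_nonneg (by linarith))
  have hl : (0 : ℝ) < 1 / 2 := by norm_num
  have := isProbabilityMeasure_twoParamExpMeasure s hl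
  have hRint : ∀ x, Integrable (R x) μ := fun x => by
    have h : Integrable id (μ.map (R x)) := by
      rw [hR x]
      exact (memLp_id_gaussianReal 1).integrable (by simp)
    exact h.comp_measurable (hRm x)
  set H : ℝ → ℝ := fun z => ⨆ x, (m x + √z * √(v x)) with hH
  have hHle : ∀ z x, m x + √z * √(v x) ≤ H z := fun z x =>
    le_ciSup (f := fun x => m x + √z * √(v x)) (Set.finite_range _).bddAbove x
  have hHmono : Monotone H := fun z z' hz => ciSup_le fun x =>
    le_trans (by gcongr) (hHle z' x)
  have hHcont : Continuous H := by
    have : H = fun z => Finset.univ.sup' Finset.univ_nonempty fun x => m x + √z * √(v x) := by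
      funext z
      exact (Finset.sup'_univ_eq_ciSup fun x => m x + √z * √(v x)).symm
    rw [this]
    exact Continuous.finset_sup'_apply _ fun x _ => by fun_prop
  -- Union bound above the upper confidence bounds of level `z`.
  have hunion : ∀ z, s ≤ z → μ {ω | H z < ⨆ x, (m x + R x ω)} ≤
      twoParamExpMeasure s (1 / 2) (Set.Ioi z) := by
    intro z hz
    have hsub : {ω | H z < ⨆ x, (m x + R x ω)} ⊆
        ⋃ x ∈ (Finset.univ : Finset 𝒳), R x ⁻¹' Set.Ioi (√z * √(v x)) := by
      intro ω hω
      obtain ⟨x, hx⟩ := exists_lt_of_lt_ciSup (show H z < ⨆ x, (m x + R x ω) from hω)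
      simp only [Finset.mem_univ, Set.iUnion_true, Set.mem_iUnion, Set.mem_preimage, Set.mem_Ioi]
      exact ⟨x, by linarith [hHle z x]⟩
    refine (measure_mono hsub).trans ((measure_biUnion_finset_le _ _).trans ?_)
    calc ∑ x, μ (R x ⁻¹' Set.Ioi (√z * √(v x)))
        ≤ ∑ _x : 𝒳, ENNReal.ofReal (Real.exp (-z / 2)) * 2⁻¹ := by
          refine Finset.sum_le_sum fun x _ => ?_
          rw [← Measure.map_apply (hRm x) measurableSet_Ioi, hR x]
          exact gaussianReal_Ioi_sqrt_le (v x) (hs0.trans hz)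
      _ = twoParamExpMeasure s (1 / 2) (Set.Ioi z) := by
          have h2 : (2 : ℝ≥0∞)⁻¹ = ENNReal.ofReal (2⁻¹) := by
            rw [ENNReal.ofReal_inv_of_pos two_pos]; simp
          rw [twoParamExpMeasure_Ioi hl hz, Finset.sum_const, Finset.card_univ, nsmul_eq_mul, h2,
            ← ENNReal.ofReal_mul (Real.exp_nonneg _), ← ENNReal.ofReal_natCast,
            ← ENNReal.ofReal_mul (by positivity)]
          congr 1
          rw [show -(1 / 2 * (z - s)) = -z / 2 + s / 2 by ring, Real.exp_add, hs,
            mul_div_cancel_left₀ _ (two_ne_zero' ℝ), Real.exp_log (by linarith)]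
          ring
  have hζ := (integrable_id_twoParamExpMeasure s hl).1
  refine integral_le_integral_of_tail_le
    (integrable_ciSup_of_fintype fun x => (integrable_const _).add (hRint x))
    (integrable_ciSup_of_fintype fun x =>
      (integrable_const _).add ((integrable_sqrt_of_integrable hζ).mul_const _)) (H s) ?_ ?_
  · filter_upwards [ae_le_twoParamExpMeasure s hl] with z hz using hHmono hz
  · intro M hM
    by_cases hex : ∃ z, M < H z
    · -- `z₀` is the largest confidence parameter whose upper confidence bounds do not exceed `M`.
      obtain ⟨B, hB⟩ := hex
      obtain ⟨z₀, ⟨hz₀, hz₀M⟩, hmax⟩ := (isCompact_Icc.inter_right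
        (isClosed_le hHcont continuous_const) : IsCompact (Set.Icc s B ∩ {z | H z ≤ M})
        ).exists_isGreatest ⟨s, ⟨le_refl s, by
          by_contra hlt
          exact absurd (hHmono (not_le.1 hlt).le) (not_le.2 (hM.trans_lt hB))⟩, hM⟩
      refine (measure_mono fun ω hω => ?_).trans ((hunion z₀ hz₀.1).trans
        (measure_mono fun z hz => ?_))
      · exact lt_of_le_of_lt hz₀M (show M < _ from hω)
      · by_contra hle
        have hle : H z ≤ M := not_lt.1 hle
        have hzB : z ≤ B := by
          by_contra hlt
          exact absurd (hHmono (not_le.1 hlt).le) (not_le.2 (hle.trans_lt hB))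
        exact absurd (hmax ⟨⟨hz₀.1.trans (le_of_lt hz), hzB⟩, hle⟩) (not_le.2 hz)
    · have hall : ∀ z, H z ≤ M := by simpa using hex
      have hle : ∀ z, s ≤ z → μ {ω | M < ⨆ x, (m x + R x ω)} ≤
          ENNReal.ofReal (Real.exp (-(1 / 2 * (z - s)))) := fun z hz => by
        rw [← twoParamExpMeasure_Ioi hl hz]
        exact (measure_mono fun ω (hω : M < _) => lt_of_le_of_lt (hall z) hω).trans (hunion z hz)
      have hlim : Filter.Tendsto (fun z : ℝ => ENNReal.ofReal (Real.exp (-(1 / 2 * (z - s)))))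
          Filter.atTop (nhds 0) := by
        rw [← ENNReal.ofReal_zero]
        refine ENNReal.tendsto_ofReal (Real.tendsto_exp_neg_atTop_nhds_zero.comp ?_)
        exact (Filter.tendsto_atTop_add_const_right _ (-s) Filter.tendsto_id).const_mul_atTop hl
      exact (ge_of_tendsto hlim ((Filter.eventually_ge_atTop s).mono hle)).trans zero_le

/-! ### Gaussian process regression at fixed query points -/

/-- The regression model: `f` is a centred Gaussian process with unit-variance kernel `k`, observed
under an independent i.i.d. Gaussian noise `ε` of positive variance `v`. -/
structure IsGPRegression {Ω 𝒳 : Type*} [MeasurableSpace Ω] (P : Measure Ω) (k : 𝒳 → 𝒳 → ℝ)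
    (v : ℝ≥0) (f : 𝒳 → Ω → ℝ) (ε : ℕ → Ω → ℝ) : Prop where
  kernel_self : ∀ x, k x x = 1
  process : IsCenteredGP P k f
  noise_pos : 0 < v
  noise_meas : ∀ t, Measurable (ε t)
  noise_law : ∀ t, HasLaw (ε t) (gaussianReal 0 v) P
  noise_indep : iIndepFun ε P
  indep : IndepFun (fun ω x => f x ω) (fun ω t => ε t ω) P

/-- The noisy observations of `f` at the points `a`. -/
def noisyObs {Ω 𝒳 : Type*} (f : 𝒳 → Ω → ℝ) (ε : ℕ → Ω → ℝ) {t : ℕ} (a : Fin t → 𝒳) (ω : Ω) :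
    Fin t → ℝ :=
  fun i => f (a i) ω + ε i ω

/-- The data set with query points `a` and observations `y`. -/
def dataOf {𝒳 : Type*} {t : ℕ} (a : Fin t → 𝒳) (y : Fin t → ℝ) : Fin t → 𝒳 × ℝ :=
  fun i => (a i, y i)

/-- The weights of the observations in the posterior mean at `x`. -/
noncomputable def postWeight {𝒳 : Type*} (k : 𝒳 → 𝒳 → ℝ) (v : ℝ) {t : ℕ} (a : Fin t → 𝒳) (x : 𝒳) :
    Fin t → ℝ :=
  kernelVec k a x ᵥ* (regKernelMatrix k v a)⁻¹

/-- The posterior variance at `x`, which does not depend on the observed values. -/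
noncomputable def designVar {𝒳 : Type*} (k : 𝒳 → 𝒳 → ℝ) (v : ℝ) {t : ℕ} (a : Fin t → 𝒳) (x : 𝒳) : ℝ :=
  k x x - postWeight k v a x ⬝ᵥ kernelVec k a x

/-- The error made by the posterior mean at `x` for the fixed query points `a`. -/
noncomputable def postResid {Ω 𝒳 : Type*} (k : 𝒳 → 𝒳 → ℝ) (v : ℝ) (f : 𝒳 → Ω → ℝ) (ε : ℕ → Ω → ℝ) {t : ℕ}
    (a : Fin t → 𝒳) (x : 𝒳) (ω : Ω) : ℝ :=
  f x ω - ∑ i, postWeight k v a x i * noisyObs f ε a ω i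

section

variable {𝒳 : Type*} (k : 𝒳 → 𝒳 → ℝ) (v : ℝ) {t : ℕ}

lemma postMean_eq_sum (D : Fin t → 𝒳 × ℝ) (x : 𝒳) :
    postMean k v D x = ∑ i, postWeight k v (fun i => (D i).1) x i * (D i).2 := by
  rw [postMean, Matrix.dotProduct_mulVec]
  rfl

lemma postVar_eq_designVar (D : Fin t → 𝒳 × ℝ) (x : 𝒳) :
    postVar k v D x = designVar k v (fun i => (D i).1) x := by
  rw [postVar, Matrix.dotProduct_mulVec]
  rfl

lemma postMean_add_postResid {Ω : Type*} (f : 𝒳 → Ω → ℝ) (ε : ℕ → Ω → ℝ) (a : Fin t → 𝒳) (x : 𝒳)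
    (ω : Ω) : postMean k v (dataOf a (noisyObs f ε a ω)) x + postResid k v f ε a x ω = f x ω := by
  rw [postMean_eq_sum]
  simp [postResid, dataOf]

end

section

variable {𝒳 : Type*} {t : ℕ}

/-- The `i`-th noisy observation as a linear function of the process and the noise. -/
noncomputable def obsCLM {n : ℕ} (ht : t ≤ n) (a : Fin t → 𝒳) (i : Fin t) :
    ((𝒳 → ℝ) × (Fin n → ℝ)) →L[ℝ] ℝ :=
  (ContinuousLinearMap.proj (R := ℝ) (φ := fun _ : 𝒳 => ℝ) (a i)).comp
      (ContinuousLinearMap.fst ℝ _ _) +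
    (ContinuousLinearMap.proj (R := ℝ) (φ := fun _ : Fin n => ℝ) (i.castLE ht)).comp
      (ContinuousLinearMap.snd ℝ _ _)

/-- The error of the posterior mean as a linear function of the process and the noise. -/
noncomputable def residCLM {n : ℕ} (ht : t ≤ n) (k : 𝒳 → 𝒳 → ℝ) (v : ℝ) (a : Fin t → 𝒳) (x : 𝒳) :
    ((𝒳 → ℝ) × (Fin n → ℝ)) →L[ℝ] ℝ :=
  (ContinuousLinearMap.proj (R := ℝ) (φ := fun _ : 𝒳 => ℝ) x).comp
      (ContinuousLinearMap.fst ℝ _ _) -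
    ∑ i, postWeight k v a x i • obsCLM ht a i

lemma noisyObs_eq_obsCLM {Ω : Type*} {n : ℕ} (ht : t ≤ n) (f : 𝒳 → Ω → ℝ) (ε : ℕ → Ω → ℝ) (a : Fin t → 𝒳)
    (i : Fin t) (ω : Ω) :
    noisyObs f ε a ω i = obsCLM ht a i ((fun x => f x ω), (fun i : Fin n => ε i ω)) := rfl

lemma postResid_eq_residCLM {Ω : Type*} {n : ℕ} (ht : t ≤ n) (k : 𝒳 → 𝒳 → ℝ) (v : ℝ) (f : 𝒳 → Ω → ℝ)
    (ε : ℕ → Ω → ℝ) (a : Fin t → 𝒳) (x : 𝒳) (ω : Ω) :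
    postResid k v f ε a x ω =
      residCLM ht k v a x ((fun x => f x ω), (fun i : Fin n => ε i ω)) := by
  simp only [postResid, residCLM, sub_apply, sum_apply, smul_apply,
    ← noisyObs_eq_obsCLM ht f ε a]
  rfl

end

namespace IsGPRegression

variable {Ω 𝒳 : Type*} [MeasurableSpace Ω] {P : Measure Ω}
  {k : 𝒳 → 𝒳 → ℝ} {v : ℝ≥0} {f : 𝒳 → Ω → ℝ} {ε : ℕ → Ω → ℝ}

lemma memLp_process (h : IsGPRegression P k v f ε) (x : 𝒳) : MemLp (f x) 2 P :=
  (h.process.gaussian.hasGaussianLaw_eval x).memLp_two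

lemma memLp_noise (h : IsGPRegression P k v f ε) (n : ℕ) : MemLp (ε n) 2 P :=
  (h.noise_law n).hasGaussianLaw.memLp_two

lemma integral_noise (h : IsGPRegression P k v f ε) (n : ℕ) : ∫ ω, ε n ω ∂P = 0 := by
  rw [(h.noise_law n).integral_eq, integral_id_gaussianReal]

lemma indepFun_process_noise (h : IsGPRegression P k v f ε) (x : 𝒳) (n : ℕ) :
    IndepFun (f x) (ε n) P :=
  h.indep.comp (measurable_pi_apply x) (measurable_pi_apply n)

lemma cov_noise (h : IsGPRegression P k v f ε) (m n : ℕ) :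
    cov[ε m, ε n; P] = if m = n then (v : ℝ) else 0 := by
  split_ifs with hmn
  · subst hmn
    rw [covariance_self (h.noise_meas m).aemeasurable, (h.noise_law m).variance_eq,
      variance_id_gaussianReal]
  · exact (h.noise_indep.indepFun hmn).covariance_eq_zero (h.memLp_noise m) (h.memLp_noise n)

lemma cov_process_noise (h : IsGPRegression P k v f ε) (x : 𝒳) (n : ℕ) :
    cov[f x, ε n; P] = 0 :=
  (h.indepFun_process_noise x n).covariance_eq_zero (h.memLp_process x) (h.memLp_noise n)

variable {t : ℕ}

lemma measurable_noisyObs (h : IsGPRegression P k v f ε) (a : Fin t → 𝒳) :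
    Measurable (noisyObs f ε a) :=
  measurable_pi_lambda _ fun i => (h.process.measurable (a i)).add (h.noise_meas i)

lemma memLp_noisyObs (h : IsGPRegression P k v f ε) (a : Fin t → 𝒳) (i : Fin t) :
    MemLp (fun ω => noisyObs f ε a ω i) 2 P :=
  (h.memLp_process (a i)).add (h.memLp_noise i)

lemma measurable_postResid (h : IsGPRegression P k v f ε) (a : Fin t → 𝒳) (x : 𝒳) :
    Measurable (postResid k v f ε a x) :=
  (h.process.measurable x).sub (Finset.measurable_sum _ fun i _ =>
    ((measurable_pi_apply i).comp (h.measurable_noisyObs a)).const_mul _)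

lemma memLp_weightedObs (h : IsGPRegression P k v f ε) (a : Fin t → 𝒳) (x : 𝒳) :
    MemLp (fun ω => ∑ i, postWeight k v a x i * noisyObs f ε a ω i) 2 P :=
  memLp_finsetSum _ fun i _ => (h.memLp_noisyObs a i).const_mul _

lemma memLp_postResid (h : IsGPRegression P k v f ε) (a : Fin t → 𝒳) (x : 𝒳) :
    MemLp (postResid k v f ε a x) 2 P :=
  (h.memLp_process x).sub (h.memLp_weightedObs a x)

/-- The values of the process and finitely many noise variables are jointly Gaussian. -/
lemma hasGaussianLaw_process_noise [Fintype 𝒳] (h : IsGPRegression P k v f ε) (n : ℕ) :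
    HasGaussianLaw (fun ω => ((fun x => f x ω), (fun i : Fin n => ε i ω))) P := by
  classical
  have hf : HasGaussianLaw (fun ω x => f x ω) P := by
    let L : (↥(Finset.univ : Finset 𝒳) → ℝ) →L[ℝ] (𝒳 → ℝ) :=
      ContinuousLinearMap.pi fun x =>
        ContinuousLinearMap.proj (⟨x, Finset.mem_univ x⟩ : (Finset.univ : Finset 𝒳))
    exact (h.process.gaussian.hasGaussianLaw Finset.univ).map_fun L
  have hε : HasGaussianLaw (fun ω (i : Fin n) => ε i ω) P :=
    iIndepFun.hasGaussianLaw (fun i => (h.noise_law i).hasGaussianLaw)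
      (h.noise_indep.precomp Fin.val_injective)
  refine IndepFun.hasGaussianLaw hf hε (h.indep.comp measurable_id
    (measurable_pi_lambda _ fun i : Fin n => measurable_pi_apply (i : ℕ)))

/-- Two families of linear functions of the process and the noise are independent as soon as they
are uncorrelated. -/
lemma indepFun_of_cov_eq_zero [Fintype 𝒳] (h : IsGPRegression P k v f ε) {ι κ : Type*} [Finite ι] [Finite κ]
    {n : ℕ} (A : ι → ((𝒳 → ℝ) × (Fin n → ℝ)) →L[ℝ] ℝ) (B : κ → ((𝒳 → ℝ) × (Fin n → ℝ)) →L[ℝ] ℝ)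
    {X : ι → Ω → ℝ} {Y : κ → Ω → ℝ}
    (hX : ∀ i ω, X i ω = A i ((fun x => f x ω), (fun i : Fin n => ε i ω)))
    (hY : ∀ j ω, Y j ω = B j ((fun x => f x ω), (fun i : Fin n => ε i ω)))
    (hcov : ∀ i j, cov[X i, Y j; P] = 0) :
    IndepFun (fun ω i => X i ω) (fun ω j => Y j ω) P := by
  have := Fintype.ofFinite ι
  have := Fintype.ofFinite κ
  refine HasGaussianLaw.indepFun_of_covariance_eval ?_ hcov
  simp only [hX, hY]
  exact (h.hasGaussianLaw_process_noise n).map_fun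
    ((ContinuousLinearMap.pi A).prod (ContinuousLinearMap.pi B))

variable [IsProbabilityMeasure P]

lemma integral_noisyObs (h : IsGPRegression P k v f ε) (a : Fin t → 𝒳) (i : Fin t) :
    ∫ ω, noisyObs f ε a ω i ∂P = 0 := by
  simp only [noisyObs]
  rw [integral_add ((h.memLp_process (a i)).integrable one_le_two)
    ((h.memLp_noise i).integrable one_le_two), h.process.mean_zero, h.integral_noise, add_zero]

lemma integral_postResid (h : IsGPRegression P k v f ε) (a : Fin t → 𝒳) (x : 𝒳) :
    ∫ ω, postResid k v f ε a x ω ∂P = 0 := by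
  simp only [postResid]
  rw [integral_sub ((h.memLp_process x).integrable one_le_two)
    ((h.memLp_weightedObs a x).integrable one_le_two), h.process.mean_zero,
    integral_finsetSum _ fun i _ => ((h.memLp_noisyObs a i).integrable one_le_two).const_mul _]
  simp [integral_const_mul, h.integral_noisyObs]

lemma cov_process_noisyObs (h : IsGPRegression P k v f ε) (a : Fin t → 𝒳) (x : 𝒳) (j : Fin t) :
    cov[f x, fun ω => noisyObs f ε a ω j; P] = kernelVec k a x j := by
  have := covariance_add_right (h.memLp_process x) (h.memLp_process (a j)) (h.memLp_noise j)
  rw [h.cov_process_noise, add_zero, h.process.cov_eq] at this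
  exact this

lemma cov_noisyObs_noise (h : IsGPRegression P k v f ε) (a : Fin t → 𝒳) (i : Fin t) (n : ℕ) :
    cov[fun ω => noisyObs f ε a ω i, ε n; P] = if (i : ℕ) = n then (v : ℝ) else 0 := by
  have := covariance_add_left (h.memLp_process (a i)) (h.memLp_noise i) (h.memLp_noise n)
  rw [h.cov_process_noise, zero_add, h.cov_noise] at this
  exact this

lemma cov_noisyObs (h : IsGPRegression P k v f ε) (a : Fin t → 𝒳) (i j : Fin t) :
    cov[fun ω => noisyObs f ε a ω i, fun ω => noisyObs f ε a ω j; P] =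
      regKernelMatrix k v a i j := by
  have := covariance_add_right (h.memLp_noisyObs a i) (h.memLp_process (a j)) (h.memLp_noise j)
  rw [h.cov_noisyObs_noise, covariance_comm _ (f (a j)), h.cov_process_noisyObs, kernelVec,
    ← h.process.cov_eq, covariance_comm (f (a j)), h.process.cov_eq] at this
  refine this.trans ?_
  simp [regKernelMatrix, Matrix.one_apply, Fin.ext_iff]

lemma regKernelMatrix_posDef (h : IsGPRegression P k v f ε) (a : Fin t → 𝒳) :
    (regKernelMatrix k v a).PosDef := by
  refine Matrix.PosDef.of_dotProduct_mulVec_pos ?_ fun c hc => ?_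
  · ext i j
    rw [Matrix.conjTranspose_apply, star_trivial, ← h.cov_noisyObs, ← h.cov_noisyObs,
      covariance_comm]
  · have hpos : 0 < c ⬝ᵥ c := by
      refine lt_of_le_of_ne (Finset.sum_nonneg fun i _ => mul_self_nonneg _) fun h0 => hc ?_
      exact dotProduct_self_eq_zero.1 h0.symm
    have hnn : 0 ≤ c ⬝ᵥ (Matrix.of (fun i j => k (a i) (a j)) *ᵥ c) := by
      have hm : ∀ i, MemLp (fun ω => c i * f (a i) ω) 2 P := fun i =>
        (h.memLp_process (a i)).const_mul _
      have hcov := covariance_fun_sum_fun_sum hm hm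
      rw [covariance_self (by exact (memLp_finsetSum _ fun i _ => hm i).aemeasurable)] at hcov
      refine (variance_nonneg _ _).trans_eq (hcov.trans ?_)
      simp only [dotProduct, Matrix.mulVec, Matrix.of_apply, Finset.mul_sum]
      refine Finset.sum_congr rfl fun i _ => Finset.sum_congr rfl fun j _ => ?_
      rw [covariance_const_mul_left, covariance_const_mul_right, h.process.cov_eq]
      ring
    have hv : (0 : ℝ) < v := h.noise_pos
    rw [star_trivial, regKernelMatrix, Matrix.add_mulVec, dotProduct_add, Matrix.smul_mulVec,
      Matrix.one_mulVec, dotProduct_smul, smul_eq_mul]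
    positivity

/-- The normal equations of the posterior mean. -/
lemma postWeight_vecMul (h : IsGPRegression P k v f ε) (a : Fin t → 𝒳) (x : 𝒳) :
    postWeight k v a x ᵥ* regKernelMatrix k v a = kernelVec k a x := by
  rw [postWeight, Matrix.vecMul_vecMul, Matrix.nonsing_inv_mul, Matrix.vecMul_one]
  exact (Matrix.isUnit_iff_isUnit_det _).1 (h.regKernelMatrix_posDef a).isUnit

lemma cov_weightedObs_left (h : IsGPRegression P k v f ε) (a : Fin t → 𝒳) (x : 𝒳) {Z : Ω → ℝ}
    (hZ : MemLp Z 2 P) :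
    cov[fun ω => ∑ i, postWeight k v a x i * noisyObs f ε a ω i, Z; P] =
      ∑ i, postWeight k v a x i * cov[fun ω => noisyObs f ε a ω i, Z; P] := by
  rw [covariance_fun_sum_left (fun i => (h.memLp_noisyObs a i).const_mul _) hZ]
  simp only [covariance_const_mul_left]

lemma cov_postResid_left (h : IsGPRegression P k v f ε) (a : Fin t → 𝒳) (x : 𝒳) {Z : Ω → ℝ}
    (hZ : MemLp Z 2 P) :
    cov[postResid k v f ε a x, Z; P] = cov[f x, Z; P] -
      ∑ i, postWeight k v a x i * cov[fun ω => noisyObs f ε a ω i, Z; P] := by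
  rw [← h.cov_weightedObs_left a x hZ,
    ← covariance_fun_sub_left (h.memLp_process x) (h.memLp_weightedObs a x) hZ]
  rfl

lemma cov_postResid_noisyObs (h : IsGPRegression P k v f ε) (a : Fin t → 𝒳) (x : 𝒳) (j : Fin t) :
    cov[postResid k v f ε a x, fun ω => noisyObs f ε a ω j; P] = 0 := by
  rw [h.cov_postResid_left a x (h.memLp_noisyObs a j), h.cov_process_noisyObs]
  simp only [h.cov_noisyObs]
  rw [sub_eq_zero, ← h.postWeight_vecMul]
  rfl

lemma cov_postResid_noise (h : IsGPRegression P k v f ε) (a : Fin t → 𝒳) (x : 𝒳) {n : ℕ}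
    (hn : t ≤ n) : cov[postResid k v f ε a x, ε n; P] = 0 := by
  rw [h.cov_postResid_left a x (h.memLp_noise n), h.cov_process_noise]
  have : ∀ i : Fin t, (i : ℕ) ≠ n := fun i => by omega
  simp [h.cov_noisyObs_noise, this]

lemma cov_postResid_weightedObs (h : IsGPRegression P k v f ε) (a : Fin t → 𝒳) (x : 𝒳) :
    cov[postResid k v f ε a x, fun ω => ∑ i, postWeight k v a x i * noisyObs f ε a ω i; P] = 0 := by
  rw [covariance_comm, h.cov_weightedObs_left a x (h.memLp_postResid a x)]
  refine Finset.sum_eq_zero fun i _ => ?_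
  rw [covariance_comm, h.cov_postResid_noisyObs, mul_zero]

lemma designVar_eq_cov_process (h : IsGPRegression P k v f ε) (a : Fin t → 𝒳) (x : 𝒳) :
    designVar k v a x = cov[postResid k v f ε a x, f x; P] := by
  rw [h.cov_postResid_left a x (h.memLp_process x), h.process.cov_eq]
  simp only [covariance_comm _ (f x), h.cov_process_noisyObs]
  rfl

lemma variance_postResid (h : IsGPRegression P k v f ε) (a : Fin t → 𝒳) (x : 𝒳) :
    Var[postResid k v f ε a x; P] = designVar k v a x := by
  have := covariance_fun_sub_right (h.memLp_postResid a x) (h.memLp_process x)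
    (h.memLp_weightedObs a x)
  rw [h.cov_postResid_weightedObs, sub_zero, ← h.designVar_eq_cov_process] at this
  rw [← this, ← covariance_self (h.measurable_postResid a x).aemeasurable]
  rfl

lemma designVar_nonneg (h : IsGPRegression P k v f ε) (a : Fin t → 𝒳) (x : 𝒳) :
    0 ≤ designVar k v a x := by
  rw [← h.variance_postResid]
  exact variance_nonneg _ _

lemma designVar_le_one (h : IsGPRegression P k v f ε) (a : Fin t → 𝒳) (x : 𝒳) :
    designVar k v a x ≤ 1 := by
  -- The variance removed by the data is the variance of the posterior mean.
  have h1 := covariance_fun_sub_right (h.memLp_weightedObs a x) (h.memLp_process x)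
    (h.memLp_weightedObs a x)
  have h2 : cov[fun ω => ∑ i, postWeight k v a x i * noisyObs f ε a ω i,
      postResid k v f ε a x; P] = 0 := by
    rw [covariance_comm, h.cov_postResid_weightedObs]
  rw [covariance_self (h.memLp_weightedObs a x).aemeasurable,
    h.cov_weightedObs_left a x (h.memLp_process x)] at h1
  simp only [covariance_comm _ (f x), h.cov_process_noisyObs] at h1
  have h3 := variance_nonneg (fun ω => ∑ i, postWeight k v a x i * noisyObs f ε a ω i) P
  have h4 : designVar k v a x = k x x - ∑ i, postWeight k v a x i * kernelVec k a x i := rfl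
  have h5 := h1.symm.trans h2
  rw [h4, h.kernel_self]
  linarith

variable [Fintype 𝒳]

/-- The error of the posterior mean is independent of the observations. -/
lemma indepFun_postResid_noisyObs (h : IsGPRegression P k v f ε) (a : Fin t → 𝒳) :
    IndepFun (fun ω x => postResid k v f ε a x ω) (noisyObs f ε a) P :=
  h.indepFun_of_cov_eq_zero (residCLM le_rfl k v a) (obsCLM le_rfl a)
    (postResid_eq_residCLM le_rfl k v f ε a) (noisyObs_eq_obsCLM le_rfl f ε a)
    (h.cov_postResid_noisyObs a)

lemma map_postResid (h : IsGPRegression P k v f ε) (a : Fin t → 𝒳) (x : 𝒳) :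
    P.map (postResid k v f ε a x) = gaussianReal 0 (designVar k v a x).toNNReal := by
  have hG : HasGaussianLaw (postResid k v f ε a x) P := by
    rw [funext (postResid_eq_residCLM le_rfl k v f ε a x)]
    exact (h.hasGaussianLaw_process_noise t).map_fun (residCLM le_rfl k v a x)
  rw [hG.map_eq_gaussianReal, h.integral_postResid, h.variance_postResid]

/-- The innovation, that is the error made in predicting the next noisy observation, is independent
of the past observations. -/
lemma indepFun_innovation_noisyObs (h : IsGPRegression P k v f ε) (a : Fin t → 𝒳) (x : 𝒳) :
    IndepFun (fun ω => postResid k v f ε a x ω + ε t ω) (noisyObs f ε a) P := by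
  have := h.indepFun_of_cov_eq_zero (ι := Unit) (fun _ => residCLM t.le_succ k v a x +
      (ContinuousLinearMap.proj (R := ℝ) (φ := fun _ : Fin (t + 1) => ℝ)
      (Fin.last t)).comp (ContinuousLinearMap.snd ℝ (𝒳 → ℝ) _)) (obsCLM t.le_succ a)
    (X := fun _ ω => postResid k v f ε a x ω + ε t ω) (Y := fun j ω => noisyObs f ε a ω j)
    (fun _ ω => by rw [postResid_eq_residCLM t.le_succ k v f ε a x ω]; rfl)
    (noisyObs_eq_obsCLM t.le_succ f ε a) fun _ j => by
      refine (covariance_add_left (h.memLp_postResid a x) (h.memLp_noise t)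
        (h.memLp_noisyObs a j)).trans ?_
      rw [h.cov_postResid_noisyObs, covariance_comm, h.cov_noisyObs_noise, if_neg j.2.ne, add_zero]
  exact this.comp (measurable_pi_apply ()) measurable_id

lemma map_innovation (h : IsGPRegression P k v f ε) (a : Fin t → 𝒳) (x : 𝒳) :
    P.map (fun ω => postResid k v f ε a x ω + ε t ω) =
      gaussianReal 0 ((designVar k v a x).toNNReal + v) := by
  have hind : IndepFun (postResid k v f ε a x) (ε t) P := by
    have := h.indepFun_of_cov_eq_zero (ι := Unit) (κ := Unit) (fun _ => residCLM t.le_succ k v a x)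
      (fun _ => (ContinuousLinearMap.proj (R := ℝ) (φ := fun _ : Fin (t + 1) => ℝ)
        (Fin.last t)).comp (ContinuousLinearMap.snd ℝ (𝒳 → ℝ) _))
      (X := fun _ ω => postResid k v f ε a x ω) (Y := fun _ ω => ε t ω)
      (fun _ => postResid_eq_residCLM t.le_succ k v f ε a x) (fun _ _ => rfl)
      fun _ _ => h.cov_postResid_noise a x le_rfl
    exact this.comp (measurable_pi_apply ()) (measurable_pi_apply ())
  have := gaussianReal_add_gaussianReal_of_indepFun hind (h.map_postResid a x)
    (h.noise_law t).map_eq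
  rwa [add_zero] at this

end IsGPRegression

/-! ### Densities of autoregressive Gaussian sequences -/

/-- The density of the first `T` terms of a sequence whose `t`-th term is Gaussian of variance
`v t` around the prediction `m t` from the previous terms. -/
noncomputable def autoregressivePDF (m : ∀ t : ℕ, (Fin t → ℝ) → ℝ) (v : ℕ → ℝ≥0) (T : ℕ)
    (y : Fin T → ℝ) : ℝ≥0∞ :=
  ∏ i : Fin T, gaussianPDF 0 (v i) (y i - m i (fun j : Fin i => y (Fin.castLE i.2.le j)))

lemma measurable_autoregressivePDF {m : ∀ t : ℕ, (Fin t → ℝ) → ℝ} (hm : ∀ t, Measurable (m t))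
    (v : ℕ → ℝ≥0) (T : ℕ) : Measurable (autoregressivePDF m v T) := by
  refine Finset.measurable_prod _ fun i _ => (measurable_gaussianPDF _ _).comp ?_
  exact (measurable_pi_apply i).sub ((hm i).comp (measurable_pi_lambda _ fun j =>
    measurable_pi_apply _))

lemma autoregressivePDF_succ (m : ∀ t : ℕ, (Fin t → ℝ) → ℝ) (v : ℕ → ℝ≥0) (T : ℕ)
    (x : ℝ) (y : Fin T → ℝ) :
    autoregressivePDF m v (T + 1) (Fin.snoc (α := fun _ => ℝ) y x) =
      autoregressivePDF m v T y * gaussianPDF 0 (v T) (x - m T y) := by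
  rw [autoregressivePDF, Fin.prod_univ_castSucc, autoregressivePDF]
  congr 1
  · refine Finset.prod_congr rfl fun i _ => ?_
    rw [Fin.snoc_castSucc]
    exact congrArg (fun u => gaussianPDF 0 (v i) (y i - m i u))
      (funext fun j => Fin.snoc_castSucc (α := fun _ => ℝ) x y (Fin.castLE i.2.le j))
  · rw [Fin.snoc_last]
    congr 2
    simp only [Fin.val_last]
    congr 1
    funext j
    exact Fin.snoc_castSucc (α := fun _ => ℝ) x y j

lemma lintegral_pi_fin_succ (T : ℕ) {g : (Fin (T + 1) → ℝ) → ℝ≥0∞} (hg : Measurable g) :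
    ∫⁻ z, g z = ∫⁻ y : Fin T → ℝ, ∫⁻ x : ℝ, g (Fin.snoc (α := fun _ => ℝ) y x) := by
  have h := (volume_preserving_piFinSuccAbove (fun _ : Fin (T + 1) => ℝ) (Fin.last T)).symm
  rw [← h.lintegral_comp hg, Measure.volume_eq_prod, lintegral_prod_symm _ (by fun_prop)]
  refine lintegral_congr fun y => lintegral_congr fun x => ?_
  congr 1
  exact Fin.insertNth_last (α := fun _ => ℝ) x y

lemma measurable_fin_snoc (T : ℕ) :
    Measurable fun p : (Fin T → ℝ) × ℝ => Fin.snoc (α := fun _ => ℝ) p.1 p.2 := by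
  have h := (MeasurableEquiv.piFinSuccAbove (fun _ : Fin (T + 1) => ℝ) (Fin.last T)).symm.measurable
  have heq : (fun p : (Fin T → ℝ) × ℝ => Fin.snoc (α := fun _ => ℝ) p.1 p.2) =
      (MeasurableEquiv.piFinSuccAbove (fun _ : Fin (T + 1) => ℝ) (Fin.last T)).symm ∘ Prod.swap :=
    funext fun p => (Fin.insertNth_last (α := fun _ => ℝ) p.2 p.1).symm
  rw [heq]
  exact h.comp measurable_swap

/-- A sequence whose innovations are Gaussian and independent of the past has the product density
`autoregressivePDF`. -/
theorem map_eq_withDensity_autoregressivePDF {Ω : Type*} [MeasurableSpace Ω] {P : Measure Ω}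
    [IsProbabilityMeasure P] {Y : ℕ → Ω → ℝ} (hY : ∀ t, Measurable (Y t))
    {m : ∀ t : ℕ, (Fin t → ℝ) → ℝ} (hm : ∀ t, Measurable (m t)) {v : ℕ → ℝ≥0} (hv : ∀ t, v t ≠ 0)
    (hind : ∀ t, IndepFun (fun ω => Y t ω - m t (fun j : Fin t => Y j ω))
      (fun ω (j : Fin t) => Y j ω) P)
    (hlaw : ∀ t, P.map (fun ω => Y t ω - m t (fun j : Fin t => Y j ω)) = gaussianReal 0 (v t))
    (T : ℕ) :
    P.map (fun ω (i : Fin T) => Y i ω) = volume.withDensity (autoregressivePDF m v T) := by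
  have hYT : ∀ T : ℕ, Measurable fun ω (i : Fin T) => Y i ω := fun T =>
    measurable_pi_lambda _ fun i => hY i
  induction T with
  | zero =>
    refine Measure.ext_of_lintegral _ fun g hg => ?_
    rw [lintegral_map hg (hYT 0), lintegral_withDensity_eq_lintegral_mul _
      (measurable_autoregressivePDF hm v 0) hg]
    simp only [Pi.mul_apply, autoregressivePDF, Finset.univ_eq_empty, Finset.prod_empty, one_mul]
    rw [volume_pi, Measure.pi_of_empty _ (fun i => i.elim0), lintegral_dirac' _ hg]
    simp only [Subsingleton.elim (fun i : Fin 0 => Y i _) (fun i => i.elim0)]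
    simp
  | succ T ih =>
    have hE : Measurable fun ω => Y T ω - m T (fun j : Fin T => Y j ω) :=
      (hY T).sub ((hm T).comp (hYT T))
    have hd := measurable_autoregressivePDF hm v
    refine Measure.ext_of_lintegral _ fun g hg => ?_
    have hgs : Measurable fun p : (Fin T → ℝ) × ℝ => g (Fin.snoc (α := fun _ => ℝ) p.1 p.2) :=
      hg.comp (measurable_fin_snoc T)
    have hgm : Measurable fun p : (Fin T → ℝ) × ℝ =>
        g (Fin.snoc (α := fun _ => ℝ) p.1 (p.2 + m T p.1)) :=
      hgs.comp (measurable_fst.prodMk (measurable_snd.add ((hm T).comp measurable_fst)))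
    have hsplit : ∀ ω, (fun i : Fin (T + 1) => Y i ω) = Fin.snoc (α := fun _ => ℝ)
        (fun j : Fin T => Y j ω)
        ((Y T ω - m T (fun j : Fin T => Y j ω)) + m T (fun j : Fin T => Y j ω)) := fun ω => by
      rw [sub_add_cancel]
      funext i
      refine Fin.lastCases ?_ (fun j => ?_) i
      · rw [Fin.snoc_last]; rfl
      · rw [Fin.snoc_castSucc]; rfl
    calc ∫⁻ z, g z ∂P.map (fun ω (i : Fin (T + 1)) => Y i ω)
        = ∫⁻ p, g (Fin.snoc (α := fun _ => ℝ) p.1 (p.2 + m T p.1))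
            ∂P.map (fun ω => ((fun j : Fin T => Y j ω),
              Y T ω - m T (fun j : Fin T => Y j ω))) := by
          rw [lintegral_map hg (hYT _), lintegral_map hgm ((hYT T).prodMk hE)]
          exact lintegral_congr fun ω => by rw [hsplit ω]
      _ = ∫⁻ y, ∫⁻ x, g (Fin.snoc (α := fun _ => ℝ) y (x + m T y)) ∂gaussianReal 0 (v T)
            ∂(volume.withDensity (autoregressivePDF m v T)) := by
          rw [(indepFun_iff_map_prod_eq_prod_map_map (hYT T).aemeasurable hE.aemeasurable).1
            (hind T).symm, ih, hlaw, lintegral_prod _ hgm.aemeasurable]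
      _ = ∫⁻ y, ∫⁻ x, autoregressivePDF m v T y * (gaussianPDF 0 (v T) (x - m T y) *
            g (Fin.snoc (α := fun _ => ℝ) y x)) := by
          rw [lintegral_withDensity_eq_lintegral_mul _ (hd T) hgm.lintegral_prod_right']
          refine lintegral_congr fun y => ?_
          have hgy : Measurable fun x : ℝ => g (Fin.snoc (α := fun _ => ℝ) y x) :=
            hgs.comp measurable_prodMk_left
          have hgy' : Measurable fun x : ℝ => g (Fin.snoc (α := fun _ => ℝ) y (x + m T y)) :=
            hgy.comp (measurable_add_const _)
          simp only
          rw [Pi.mul_apply, lintegral_const_mul _ (by fun_prop), gaussianReal_of_var_ne_zero _ (hv T),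
            lintegral_withDensity_eq_lintegral_mul _ (measurable_gaussianPDF _ _) hgy']
          congr 1
          rw [← lintegral_sub_right_eq_self _ (m T y)]
          simp
      _ = ∫⁻ z, g z ∂(volume.withDensity (autoregressivePDF m v (T + 1))) := by
          rw [lintegral_withDensity_eq_lintegral_mul _ (hd _) hg,
            lintegral_pi_fin_succ T ((hd _).mul hg)]
          refine lintegral_congr fun y => lintegral_congr fun x => ?_
          rw [Pi.mul_apply, autoregressivePDF_succ, mul_assoc]

/-! ### Kullback–Leibler divergence between measures with explicit densities -/

/-- The divergence of two probability measures with positive densities for a common reference measure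
is the mean log-likelihood ratio, as soon as the latter is integrable. -/
theorem klDiv_withDensity {α : Type*} [MeasurableSpace α] {lam : Measure α} [SigmaFinite lam]
    {p q : α → ℝ≥0∞} (hp : Measurable p) (hq : Measurable q) (hp0 : ∀ z, p z ≠ 0)
    (hpt : ∀ z, p z ≠ ∞) (hq0 : ∀ z, q z ≠ 0) (hqt : ∀ z, q z ≠ ∞)
    [IsProbabilityMeasure (lam.withDensity p)] [IsProbabilityMeasure (lam.withDensity q)]
    (hint : Integrable (fun z => Real.log (p z).toReal - Real.log (q z).toReal)
      (lam.withDensity p)) :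
    klDiv (lam.withDensity p) (lam.withDensity q) ≠ ∞ ∧
    (klDiv (lam.withDensity p) (lam.withDensity q)).toReal =
      ∫ z, (Real.log (p z).toReal - Real.log (q z).toReal) ∂(lam.withDensity p) := by
  have hpq : lam.withDensity p = (lam.withDensity q).withDensity (p / q) := by
    rw [← withDensity_mul _ hq (hp.div hq)]
    congr 1
    funext z
    exact (ENNReal.mul_div_cancel (hq0 z) (hqt z)).symm
  have hac : lam.withDensity p ≪ lam.withDensity q := by
    rw [hpq]
    exact withDensity_absolutelyContinuous _ _
  have hllr : llr (lam.withDensity p) (lam.withDensity q) =ᵐ[lam.withDensity p]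
      fun z => Real.log (p z).toReal - Real.log (q z).toReal := by
    have hrn := Measure.rnDeriv_withDensity (lam.withDensity q) (hp.div hq)
    rw [← hpq] at hrn
    filter_upwards [hac.ae_le hrn] with z hz
    rw [llr, hz, Pi.div_apply, ENNReal.toReal_div, Real.log_div]
    · exact (ENNReal.toReal_pos (hp0 z) (hpt z)).ne'
    · exact (ENNReal.toReal_pos (hq0 z) (hqt z)).ne'
  refine ⟨klDiv_ne_top hac (hint.congr hllr.symm), ?_⟩
  rw [toReal_klDiv_of_measure_eq hac (by simp), integral_congr_ae hllr]

lemma autoregressivePDF_ne_zero (m : ∀ t : ℕ, (Fin t → ℝ) → ℝ) {v : ℕ → ℝ≥0} (hv : ∀ t, v t ≠ 0)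
    (T : ℕ) (y : Fin T → ℝ) : autoregressivePDF m v T y ≠ 0 :=
  Finset.prod_ne_zero_iff.2 fun i _ => (gaussianPDF_pos 0 (hv i) _).ne'

lemma autoregressivePDF_ne_top (m : ∀ t : ℕ, (Fin t → ℝ) → ℝ) (v : ℕ → ℝ≥0)
    (T : ℕ) (y : Fin T → ℝ) : autoregressivePDF m v T y ≠ ∞ :=
  ENNReal.prod_ne_top fun _ _ => gaussianPDF_ne_top

lemma log_autoregressivePDF (m : ∀ t : ℕ, (Fin t → ℝ) → ℝ) {v : ℕ → ℝ≥0} (hv : ∀ t, v t ≠ 0)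
    (T : ℕ) (y : Fin T → ℝ) :
    Real.log (autoregressivePDF m v T y).toReal = ∑ i : Fin T,
      Real.log (gaussianPDFReal 0 (v i) (y i - m i (fun j : Fin i => y (Fin.castLE i.2.le j)))) := by
  rw [autoregressivePDF, ENNReal.toReal_prod, Real.log_prod]
  · simp only [toReal_gaussianPDF]
  · intro i _
    rw [toReal_gaussianPDF]
    exact (gaussianPDFReal_pos _ _ _ (hv i)).ne'

lemma log_gaussianPDFReal {v : ℝ≥0} (hv : v ≠ 0) (x : ℝ) :
    Real.log (gaussianPDFReal 0 v x) =
      -(Real.log (2 * Real.pi * v) / 2) - x ^ 2 * (2 * v : ℝ)⁻¹ := by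
  have hv' : (0 : ℝ) < v := by positivity
  rw [gaussianPDFReal, Real.log_mul (by positivity) (Real.exp_ne_zero _), Real.log_exp,
    Real.log_inv, Real.log_sqrt (by positivity)]
  ring

lemma integral_log_gaussianPDFReal {Ω : Type*} [MeasurableSpace Ω] {P : Measure Ω}
    [IsProbabilityMeasure P] {v : ℝ≥0} (hv : v ≠ 0) {E : Ω → ℝ} (hE : Measurable E)
    (hlaw : P.map E = gaussianReal 0 v) :
    Integrable (fun ω => Real.log (gaussianPDFReal 0 v (E ω))) P ∧
      ∫ ω, Real.log (gaussianPDFReal 0 v (E ω)) ∂P =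
        -(Real.log (2 * Real.pi * v) / 2) - 1 / 2 := by
  have hL : HasLaw E (gaussianReal 0 v) P := ⟨hE.aemeasurable, hlaw⟩
  have hmem : MemLp E 2 P := hL.hasGaussianLaw.memLp_two
  have hmean : ∫ ω, E ω ∂P = 0 := by rw [hL.integral_eq, integral_id_gaussianReal]
  have hsq : ∫ ω, E ω ^ 2 ∂P = v := by
    rw [← variance_of_integral_eq_zero hE.aemeasurable hmean, hL.variance_eq,
      variance_id_gaussianReal]
  have hv' : (v : ℝ) ≠ 0 := by exact_mod_cast hv
  simp only [log_gaussianPDFReal hv]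
  have hsqi := (hmem.integrable_sq.mul_const (2 * v : ℝ)⁻¹)
  refine ⟨(integrable_const _).sub hsqi, ?_⟩
  rw [integral_sub (integrable_const _) hsqi, integral_mul_const, hsq]
  simp only [integral_const, probReal_univ, one_smul]
  field_simp

/-! ### Information gain as a sum of posterior variances -/

lemma measurable_postMean_dataOf {𝒳 : Type*} (k : 𝒳 → 𝒳 → ℝ) (v : ℝ) {t : ℕ} (a : Fin t → 𝒳) (x : 𝒳) :
    Measurable fun y => postMean k v (dataOf a y) x := by
  simp only [postMean_eq_sum, dataOf]
  fun_prop

lemma obs_sub_postMean {Ω 𝒳 : Type*} (k : 𝒳 → 𝒳 → ℝ) (v : ℝ) (f : 𝒳 → Ω → ℝ)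
    (ε : ℕ → Ω → ℝ) (b : ℕ → 𝒳) (t : ℕ) (ω : Ω) :
    f (b t) ω + ε t ω - postMean k v (dataOf (fun i : Fin t => b i)
      (noisyObs f ε (fun i : Fin t => b i) ω)) (b t) =
      postResid k v f ε (fun i : Fin t => b i) (b t) ω + ε t ω := by
  rw [← postMean_add_postResid k v f ε (fun i : Fin t => b i) (b t) ω]
  ring

lemma mutualInfo_le_maxInfoGain {Ω 𝒳 : Type*} [MeasurableSpace Ω] (P : Measure Ω) (f : 𝒳 → Ω → ℝ)
    (ε : ℕ → Ω → ℝ) (b : ℕ → 𝒳) (T : ℕ) :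
    mutualInfo P (noisyObs f ε (fun i : Fin T => b i)) (fun ω (i : Fin T) => f (b i) ω) ≤
      maxInfoGain P f ε T :=
  le_iSup (fun a : Fin T → 𝒳 => mutualInfo P (fun ω (i : Fin T) => f (a i) ω + ε i ω)
    (fun ω (i : Fin T) => f (a i) ω)) (fun i : Fin T => b i)

namespace IsGPRegression

variable {Ω 𝒳 : Type*} [MeasurableSpace Ω] {P : Measure Ω} [IsProbabilityMeasure P]
  {k : 𝒳 → 𝒳 → ℝ} {v : ℝ≥0} {f : 𝒳 → Ω → ℝ} {ε : ℕ → Ω → ℝ}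

/-- The noise is autoregressive with vanishing predictions. -/
lemma map_noise (h : IsGPRegression P k v f ε) (T : ℕ) :
    P.map (fun ω (i : Fin T) => ε i ω) =
      volume.withDensity (autoregressivePDF (fun _ _ => 0) (fun _ => v) T) := by
  refine map_eq_withDensity_autoregressivePDF h.noise_meas (fun _ => measurable_const)
    (fun _ => h.noise_pos.ne') (fun t => ?_) (fun t => ?_) T
  · simp only [sub_zero]
    have := h.noise_indep.indepFun_finset {t} (Finset.range t) (by simp) h.noise_meas
    exact this.comp (φ := fun u : (↥({t} : Finset ℕ) → ℝ) => u ⟨t, by simp⟩)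
      (ψ := fun (u : ↥(Finset.range t) → ℝ) (j : Fin t) => u ⟨j, by simp⟩)
      (by fun_prop) (by fun_prop)
  · simp only [sub_zero]
    exact (h.noise_law t).map_eq

/-- The joint law of the noisy and the noiseless values at `T` points. -/
lemma map_noisyObs_process (h : IsGPRegression P k v f ε) (b : ℕ → 𝒳) (T : ℕ) :
    P.map (fun ω => (noisyObs f ε (fun i : Fin T => b i) ω, fun i : Fin T => f (b i) ω)) =
      (volume.prod (P.map (fun ω (i : Fin T) => f (b i) ω))).withDensity
        (fun p => autoregressivePDF (fun _ _ => 0) (fun _ => v) T (p.1 - p.2)) := by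
  have hF : Measurable fun ω (i : Fin T) => f (b i) ω :=
    measurable_pi_lambda _ fun i => h.process.measurable _
  have hN : Measurable fun ω (i : Fin T) => ε i ω := measurable_pi_lambda _ fun i => h.noise_meas i
  have := Measure.isProbabilityMeasure_map (μ := P) hF.aemeasurable
  have hind : IndepFun (fun ω (i : Fin T) => ε i ω) (fun ω (i : Fin T) => f (b i) ω) P :=
    h.indep.symm.comp (φ := fun (u : ℕ → ℝ) (i : Fin T) => u i)
      (ψ := fun (u : 𝒳 → ℝ) (i : Fin T) => u (b i))
      (by fun_prop) (by fun_prop)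
  have hq : Measurable (autoregressivePDF (fun _ _ => 0) (fun _ => v) T) :=
    measurable_autoregressivePDF (fun _ => measurable_const) _ _
  refine Measure.ext_of_lintegral _ fun g hg => ?_
  have hg' : Measurable fun p : (Fin T → ℝ) × (Fin T → ℝ) => g (p.1 + p.2, p.2) :=
    hg.comp (by fun_prop)
  calc ∫⁻ p, g p ∂P.map (fun ω => (noisyObs f ε (fun i : Fin T => b i) ω,
          fun i : Fin T => f (b i) ω))
      = ∫⁻ p, g (p.1 + p.2, p.2)
          ∂P.map (fun ω => ((fun i : Fin T => ε i ω), fun i : Fin T => f (b i) ω)) := by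
        rw [lintegral_map hg ((h.measurable_noisyObs _).prodMk hF),
          lintegral_map hg' (hN.prodMk hF)]
        refine lintegral_congr fun ω => ?_
        rw [add_comm]
        rfl
    _ = ∫⁻ u, (∫⁻ e, autoregressivePDF (fun _ _ => 0) (fun _ => v) T e * g (e + u, u))
          ∂(P.map (fun ω (i : Fin T) => f (b i) ω)) := by
        rw [(indepFun_iff_map_prod_eq_prod_map_map hN.aemeasurable hF.aemeasurable).1 hind,
          h.map_noise, prod_withDensity_left hq,
          lintegral_withDensity_eq_lintegral_mul _ (by fun_prop) hg',
          lintegral_prod_symm _ (by fun_prop)]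
        rfl
    _ = ∫⁻ u, (∫⁻ y, autoregressivePDF (fun _ _ => 0) (fun _ => v) T (y - u) * g (y, u))
          ∂(P.map (fun ω (i : Fin T) => f (b i) ω)) := by
        refine lintegral_congr fun u => ?_
        rw [← lintegral_sub_right_eq_self _ u]
        simp
    _ = _ := by
        rw [lintegral_withDensity_eq_lintegral_mul _ (by fun_prop) hg,
          lintegral_prod_symm _ (by fun_prop)]
        rfl

variable [Fintype 𝒳]

/-- The density of the noisy observations at the points `b`. -/
noncomputable def obsPDF (k : 𝒳 → 𝒳 → ℝ) (v : ℝ≥0) (b : ℕ → 𝒳) (T : ℕ) : (Fin T → ℝ) → ℝ≥0∞ :=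
  autoregressivePDF (fun t y => postMean k v (dataOf (fun i : Fin t => b i) y) (b t))
    (fun t => (designVar k v (fun i : Fin t => b i) (b t)).toNNReal + v) T

lemma map_noisyObs (h : IsGPRegression P k v f ε) (b : ℕ → 𝒳) (T : ℕ) :
    P.map (noisyObs f ε (fun i : Fin T => b i)) = volume.withDensity (obsPDF k v b T) := by
  have hv := h.noise_pos
  refine map_eq_withDensity_autoregressivePDF (Y := fun t ω => f (b t) ω + ε t ω)
    (fun t => (h.process.measurable _).add (h.noise_meas t))
    (fun t => measurable_postMean_dataOf k v _ _) (fun t => by positivity) (fun t => ?_)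
    (fun t => ?_) T
  · exact (funext (obs_sub_postMean k v f ε b t)).symm ▸
      h.indepFun_innovation_noisyObs (fun i : Fin t => b i) (b t)
  · exact (funext (obs_sub_postMean k v f ε b t)).symm ▸
      h.map_innovation (fun i : Fin t => b i) (b t)

/-- The information that the noisy observations carry about the process is the sum of the
information gains of the successive rounds: the log-likelihood ratio compares the innovations, of
variance `designVar + v`, with the noise, of variance `v`. -/
theorem mutualInfo_eq (h : IsGPRegression P k v f ε) (b : ℕ → 𝒳) (T : ℕ) :
    mutualInfo P (noisyObs f ε (fun i : Fin T => b i)) (fun ω (i : Fin T) => f (b i) ω) ≠ ∞ ∧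
    (mutualInfo P (noisyObs f ε (fun i : Fin T => b i))
      (fun ω (i : Fin T) => f (b i) ω)).toReal =
      ∑ t : Fin T, 1 / 2 * Real.log (1 + (v : ℝ)⁻¹ * designVar k v (fun i : Fin t => b i) (b t)) := by
  have hv := h.noise_pos
  have hF : Measurable fun ω (i : Fin T) => f (b i) ω :=
    measurable_pi_lambda _ fun i => h.process.measurable _
  have hO := h.measurable_noisyObs (fun i : Fin T => b i)
  have := Measure.isProbabilityMeasure_map (μ := P) hF.aemeasurable
  have := Measure.isProbabilityMeasure_map (μ := P) hO.aemeasurable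
  have hJ := Measure.isProbabilityMeasure_map (μ := P) (hO.prodMk hF).aemeasurable
  set w : ℕ → ℝ≥0 := fun t => (designVar k v (fun i : Fin t => b i) (b t)).toNNReal + v with hw
  have hw0 : ∀ t, w t ≠ 0 := fun t => by positivity
  have hp : Measurable fun p : (Fin T → ℝ) × (Fin T → ℝ) =>
      autoregressivePDF (fun _ _ => 0) (fun _ => v) T (p.1 - p.2) :=
    (measurable_autoregressivePDF (fun _ => measurable_const) _ _).comp
      (measurable_fst.sub measurable_snd)
  have hobs : Measurable (obsPDF k v b T) :=
    measurable_autoregressivePDF (fun t => measurable_postMean_dataOf k v _ _) _ _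
  have hq : Measurable fun p : (Fin T → ℝ) × (Fin T → ℝ) => obsPDF k v b T p.1 :=
    hobs.comp measurable_fst
  have hprod : (P.map (noisyObs f ε (fun i : Fin T => b i))).prod
      (P.map (fun ω (i : Fin T) => f (b i) ω)) =
      (volume.prod (P.map (fun ω (i : Fin T) => f (b i) ω))).withDensity
        (fun p => obsPDF k v b T p.1) := by
    rw [h.map_noisyObs, prod_withDensity_left hobs]
  have hJ' := h.map_noisyObs_process b T
  have hprob : IsProbabilityMeasure ((P.map (noisyObs f ε (fun i : Fin T => b i))).prod
      (P.map (fun ω (i : Fin T) => f (b i) ω))) := inferInstance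
  rw [hJ'] at hJ
  rw [hprod] at hprob
  -- The log-likelihood ratio along the random variables.
  have hratio : ∀ ω, Real.log (autoregressivePDF (fun _ _ => 0) (fun _ => v) T
        (noisyObs f ε (fun i : Fin T => b i) ω - fun i : Fin T => f (b i) ω)).toReal -
      Real.log (obsPDF k v b T (noisyObs f ε (fun i : Fin T => b i) ω)).toReal =
      ∑ i : Fin T, (Real.log (gaussianPDFReal 0 v (ε i ω)) - Real.log (gaussianPDFReal 0 (w i)
        (postResid k v f ε (fun j : Fin i => b j) (b i) ω + ε i ω))) := by
    intro ω
    rw [log_autoregressivePDF _ (fun _ => hv.ne'), obsPDF, log_autoregressivePDF _ hw0,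
      ← Finset.sum_sub_distrib]
    refine Finset.sum_congr rfl fun i _ => ?_
    rw [← obs_sub_postMean k v f ε b i ω]
    simp only [Pi.sub_apply, noisyObs, add_sub_cancel_left, sub_zero]
    rfl
  have hnoise := fun i : Fin T =>
    integral_log_gaussianPDFReal hv.ne' (h.noise_meas i) (h.noise_law i).map_eq
  have hinn := fun i : Fin T => integral_log_gaussianPDFReal (hw0 i)
    (E := fun ω => postResid k v f ε (fun j : Fin i => b j) (b i) ω + ε i ω) ((h.measurable_postResid _ _).add (h.noise_meas i))
    (h.map_innovation (fun j : Fin i => b j) (b i))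
  have hmeas : Measurable fun p : (Fin T → ℝ) × (Fin T → ℝ) =>
      Real.log (autoregressivePDF (fun _ _ => 0) (fun _ => v) T (p.1 - p.2)).toReal -
        Real.log (obsPDF k v b T p.1).toReal :=
    (Real.measurable_log.comp hp.ennreal_toReal).sub (Real.measurable_log.comp hq.ennreal_toReal)
  have hint : Integrable (fun p : (Fin T → ℝ) × (Fin T → ℝ) =>
      Real.log (autoregressivePDF (fun _ _ => 0) (fun _ => v) T (p.1 - p.2)).toReal -
        Real.log (obsPDF k v b T p.1).toReal)
      ((volume.prod (P.map (fun ω (i : Fin T) => f (b i) ω))).withDensity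
        (fun p => autoregressivePDF (fun _ _ => 0) (fun _ => v) T (p.1 - p.2))) := by
    rw [← hJ', integrable_map_measure hmeas.aestronglyMeasurable (hO.prodMk hF).aemeasurable]
    refine (integrable_finsetSum Finset.univ fun i _ => (hnoise i).1.sub (hinn i).1).congr
      (ae_of_all _ fun ω => ?_)
    exact (hratio ω).symm
  have key := klDiv_withDensity hp hq (fun _ => autoregressivePDF_ne_zero _ (fun _ => hv.ne') _ _)
    (fun _ => autoregressivePDF_ne_top _ _ _ _) (fun _ => autoregressivePDF_ne_zero _ hw0 _ _)
    (fun _ => autoregressivePDF_ne_top _ _ _ _) hint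
  have hMI : mutualInfo P (noisyObs f ε (fun i : Fin T => b i)) (fun ω (i : Fin T) => f (b i) ω) =
      klDiv ((volume.prod (P.map (fun ω (i : Fin T) => f (b i) ω))).withDensity
        (fun p => autoregressivePDF (fun _ _ => 0) (fun _ => v) T (p.1 - p.2)))
        ((volume.prod (P.map (fun ω (i : Fin T) => f (b i) ω))).withDensity
        (fun p => obsPDF k v b T p.1)) := by
    rw [← hJ', ← hprod]
    rfl
  rw [hMI]
  refine ⟨key.1, key.2.trans ?_⟩
  rw [← hJ', integral_map (hO.prodMk hF).aemeasurable hmeas.aestronglyMeasurable]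
  simp only [hratio]
  rw [integral_finsetSum _ fun i _ => by exact (hnoise i).1.sub (hinn i).1]
  refine Finset.sum_congr rfl fun i _ => ?_
  rw [integral_sub (hnoise i).1 (hinn i).1, (hnoise i).2, (hinn i).2]
  have hv' : (0 : ℝ) < v := hv
  have hd := h.designVar_nonneg (fun j : Fin i => b j) (b i)
  have hwi : (w i : ℝ) = v * (1 + (v : ℝ)⁻¹ * designVar k v (fun j : Fin i => b j) (b i)) := by
    rw [hw]
    push_cast
    rw [Real.coe_toNNReal _ hd]
    field_simp
    ring
  have hpos : 0 < 1 + (v : ℝ)⁻¹ * designVar k v (fun j : Fin i => b j) (b i) := by positivity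
  rw [hwi, ← mul_assoc, Real.log_mul (by positivity) hpos.ne']
  ring

theorem maxInfoGain_ne_top [Nonempty 𝒳] (h : IsGPRegression P k v f ε) (T : ℕ) :
    maxInfoGain P f ε T ≠ ∞ := by
  rw [maxInfoGain, ← lt_top_iff_ne_top, ← Finset.sup_univ_eq_iSup,
    Finset.sup_lt_iff ENNReal.zero_lt_top]
  intro a _
  let b : ℕ → 𝒳 := fun n => if hn : n < T then a ⟨n, hn⟩ else Classical.arbitrary 𝒳
  have hb : (fun i : Fin T => b i) = a := funext fun i => by simp [b]
  have := (h.mutualInfo_eq b T).1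
  simp only [show ∀ i : Fin T, b i = a i from congrFun hb] at this
  exact this.lt_top

/-- The elliptical potential bound: the posterior variances met along any sequence of queries add
up to at most a constant times the maximum information gain. By concavity of the logarithm,
`x ≤ log (1 + x / v) / log (1 + 1 / v)` for `x ∈ [0, 1]`. -/
theorem sum_designVar_le [Nonempty 𝒳] (h : IsGPRegression P k v f ε) (b : ℕ → 𝒳) (T : ℕ) :
    ∑ t ∈ Finset.range T, designVar k v (fun i : Fin t => b i) (b t) ≤
      2 / Real.log (1 + (v : ℝ)⁻¹) * (maxInfoGain P f ε T).toReal := by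
  have hv : (0 : ℝ) < v := h.noise_pos
  have hlog : 0 < Real.log (1 + (v : ℝ)⁻¹) := Real.log_pos (by simp [hv])
  have hle := ENNReal.toReal_mono (h.maxInfoGain_ne_top T)
    (mutualInfo_le_maxInfoGain P f ε b T)
  rw [(h.mutualInfo_eq b T).2, Fin.sum_univ_eq_sum_range
    (fun t => 1 / 2 * Real.log (1 + (v : ℝ)⁻¹ * designVar k v (fun i : Fin t => b i) (b t))),
    ← Finset.mul_sum] at hle
  have hterm : ∀ t, Real.log (1 + (v : ℝ)⁻¹) * designVar k v (fun i : Fin t => b i) (b t) ≤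
      Real.log (1 + (v : ℝ)⁻¹ * designVar k v (fun i : Fin t => b i) (b t)) := by
    intro t
    have h0 := h.designVar_nonneg (fun i : Fin t => b i) (b t)
    have hb := rpow_one_add_le_one_add_mul_self (s := (v : ℝ)⁻¹)
      (le_trans (by norm_num) (inv_nonneg.2 hv.le)) h0 (h.designVar_le_one _ _)
    rw [mul_comm, ← Real.log_rpow (by positivity)]
    refine Real.log_le_log (by positivity) (hb.trans_eq ?_)
    ring
  have hsum := Finset.sum_le_sum fun t (_ : t ∈ Finset.range T) => hterm t
  rw [← Finset.mul_sum] at hsum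
  rw [div_mul_eq_mul_div, le_div_iff₀ hlog]
  linarith

end IsGPRegression

/-! ### Expectations of adaptively selected variables -/

lemma measurable_apply_of_finite {Ω A : Type*} [MeasurableSpace Ω] [Countable A]
    [MeasurableSpace A] [DiscreteMeasurableSpace A] {g : A → Ω → ℝ} (hg : ∀ a, Measurable (g a))
    {X : Ω → A} (hX : Measurable X) : Measurable fun ω => g (X ω) ω :=
  (measurable_from_prod_countable_right (f := fun p : A × Ω => g p.1 p.2) hg).comp
    (hX.prodMk measurable_id)

lemma apply_eq_sum_indicator {Ω A : Type*} [Fintype A] (g : A → Ω → ℝ) (X : Ω → A) (ω : Ω) :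
    g (X ω) ω = ∑ a, (X ⁻¹' {a}).indicator (g a) ω := by
  classical
  have h : ∀ a, (X ⁻¹' {a}).indicator (g a) ω = if a = X ω then g a ω else 0 := fun a => by
    rw [Set.indicator_apply]
    exact if_congr eq_comm rfl rfl
  simp only [h, Finset.sum_ite_eq', Finset.mem_univ, if_true]

lemma integrable_apply_of_fintype {Ω A : Type*} [MeasurableSpace Ω] {P : Measure Ω} [Fintype A]
    [MeasurableSpace A] [DiscreteMeasurableSpace A] {g : A → Ω → ℝ} (hg : ∀ a, Integrable (g a) P)
    {X : Ω → A} (hX : Measurable X) : Integrable (fun ω => g (X ω) ω) P := by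
  simp only [apply_eq_sum_indicator g X]
  exact integrable_finsetSum _ fun a _ => (hg a).indicator (hX (measurableSet_singleton a))

/-- The mean of an adaptively selected variable is controlled on each event of constant selection. -/
lemma integral_apply_nonpos {Ω A : Type*} [MeasurableSpace Ω] {P : Measure Ω} [Fintype A]
    [MeasurableSpace A] [DiscreteMeasurableSpace A] {g : A → Ω → ℝ} (hg : ∀ a, Integrable (g a) P)
    {X : Ω → A} (hX : Measurable X) (h : ∀ a, ∫ ω, (X ⁻¹' {a}).indicator (g a) ω ∂P ≤ 0) :
    ∫ ω, g (X ω) ω ∂P ≤ 0 := by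
  simp only [apply_eq_sum_indicator g X]
  rw [integral_finsetSum _ fun a _ => (hg a).indicator (hX (measurableSet_singleton a))]
  exact Finset.sum_nonpos fun a _ => h a

/-- A form of Fubini's theorem: freezing an independent variable. -/
lemma integral_nonpos_of_indepFun {Ω α β : Type*} [MeasurableSpace Ω] {P : Measure Ω}
    [IsProbabilityMeasure P] [MeasurableSpace α] [MeasurableSpace β] {W : Ω → α} {V : Ω → β}
    (hW : Measurable W) (hV : Measurable V) (hWV : IndepFun W V P) {Φ : α × β → ℝ}
    (hΦ : Measurable Φ) (hint : Integrable (fun ω => Φ (W ω, V ω)) P)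
    (h : ∀ w, ∫ ω, Φ (w, V ω) ∂P ≤ 0) : ∫ ω, Φ (W ω, V ω) ∂P ≤ 0 := by
  have := Measure.isProbabilityMeasure_map (μ := P) hW.aemeasurable
  have := Measure.isProbabilityMeasure_map (μ := P) hV.aemeasurable
  have hlaw := (indepFun_iff_map_prod_eq_prod_map_map hW.aemeasurable hV.aemeasurable).1 hWV
  have hi : Integrable Φ ((P.map W).prod (P.map V)) := by
    rw [← hlaw, integrable_map_measure hΦ.aestronglyMeasurable (hW.prodMk hV).aemeasurable]
    exact hint
  rw [← integral_map (φ := fun ω => (W ω, V ω)) (hW.prodMk hV).aemeasurable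
    hΦ.aestronglyMeasurable, hlaw, integral_prod _ hi]
  refine integral_nonpos fun w => ?_
  exact (integral_map hV.aemeasurable
    (hΦ.comp measurable_prodMk_left).aestronglyMeasurable).trans_le (h w)

lemma integral_sqrt_le_sqrt_integral {Ω : Type*} [MeasurableSpace Ω] {P : Measure Ω}
    [IsProbabilityMeasure P] {Z : Ω → ℝ} (hZ : Integrable Z P) (hZ0 : 0 ≤ᵐ[P] Z) :
    ∫ ω, √(Z ω) ∂P ≤ √(∫ ω, Z ω ∂P) := by
  have hsq : (fun ω => √(Z ω) ^ 2) =ᵐ[P] Z := by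
    filter_upwards [hZ0] with ω hω using Real.sq_sqrt hω
  have hm : MemLp (fun ω => √(Z ω)) 2 P :=
    (memLp_two_iff_integrable_sq (integrable_sqrt_of_integrable hZ).1).2 (hZ.congr hsq.symm)
  have hv := variance_nonneg (fun ω => √(Z ω)) P
  rw [variance_eq_sub hm] at hv
  have h2 : ∫ ω, ((fun ω => √(Z ω)) ^ 2) ω ∂P = ∫ ω, Z ω ∂P := integral_congr_ae hsq
  rw [h2] at hv
  exact Real.le_sqrt_of_sq_le (by linarith)

/-! ### Adaptive queries -/

/-- The first `t` queries of `x`. -/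
def firstQueries {Ω 𝒳 : Type*} (x : ℕ → Ω → 𝒳) (t : ℕ) (ω : Ω) : Fin t → 𝒳 :=
  fun i => x i ω

/-- The values `((y, z), u)` of the observations, the confidence parameters and the tie-breaking
variable for which the query rule `g` asks for the points `a` in its first `t` rounds, provided that
`y` are the observations at these points. -/
def queryEvent {𝒳 𝒰 : Type*} (g : ∀ t : ℕ, 𝒰 × (Fin t → 𝒳 × ℝ) × ℝ → 𝒳) {t : ℕ} (a : Fin t → 𝒳) :
    Set (((Fin t → ℝ) × (Fin t → ℝ)) × 𝒰) :=
  {w | ∀ i : Fin t, g i (w.2, dataOf (fun j : Fin i => a (Fin.castLE i.2.le j))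
    (fun j : Fin i => w.1.1 (Fin.castLE i.2.le j)), w.1.2 i) = a i}

lemma measurable_dataOf {𝒳 : Type*} [MeasurableSpace 𝒳] {t : ℕ} (a : Fin t → 𝒳) :
    Measurable (dataOf a) :=
  measurable_pi_lambda _ fun i => measurable_const.prodMk (measurable_pi_apply i)

lemma measurableSet_queryEvent {𝒳 𝒰 : Type*} [MeasurableSpace 𝒳] [DiscreteMeasurableSpace 𝒳]
    [MeasurableSpace 𝒰] {g : ∀ t : ℕ, 𝒰 × (Fin t → 𝒳 × ℝ) × ℝ → 𝒳} (hg : ∀ t, Measurable (g t))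
    {t : ℕ} (a : Fin t → 𝒳) : MeasurableSet (queryEvent g a) := by
  have : queryEvent g a = ⋂ i : Fin t, {w | g i (w.2, dataOf
      (fun j : Fin i => a (Fin.castLE i.2.le j))
      (fun j : Fin i => w.1.1 (Fin.castLE i.2.le j)), w.1.2 i) = a i} := by
    ext w
    simp [queryEvent]
  rw [this]
  refine MeasurableSet.iInter fun i => ?_
  refine ((hg i).comp (measurable_snd.prodMk (((measurable_dataOf _).comp ?_).prodMk ?_)))
    (measurableSet_singleton (a i))
  · fun_prop
  · fun_prop

section

variable {Ω 𝒳 𝒰 : Type*} {f : 𝒳 → Ω → ℝ} {ε ζ : ℕ → Ω → ℝ} {U : Ω → 𝒰} {x : ℕ → Ω → 𝒳}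

lemma dataset_eq_dataOf (t : ℕ) (ω : Ω) :
    dataset f ε x t ω = dataOf (firstQueries x t ω) (noisyObs f ε (firstQueries x t ω) ω) := rfl

/-- Adaptivity is harmless: whether the first queries are `a` is decided by the observations that
the *fixed* points `a` would produce, and by the exogenous randomness. -/
lemma firstQueries_eq_iff {g : ∀ t : ℕ, 𝒰 × (Fin t → 𝒳 × ℝ) × ℝ → 𝒳}
    (hg : ∀ t ω, x t ω = g t (U ω, dataset f ε x t ω, ζ t ω)) {t : ℕ} (a : Fin t → 𝒳) (ω : Ω) :
    firstQueries x t ω = a ↔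
      ((noisyObs f ε a ω, fun i : Fin t => ζ i ω), U ω) ∈ queryEvent g a := by
  have hdata : ∀ i : Fin t, (∀ j : Fin i, x j ω = a (Fin.castLE i.2.le j)) →
      dataset f ε x i ω = dataOf (fun j : Fin i => a (Fin.castLE i.2.le j))
        (fun j : Fin i => noisyObs f ε a ω (Fin.castLE i.2.le j)) := by
    intro i hi
    funext j
    simp only [dataset, dataOf, noisyObs, hi j]
    rfl
  constructor
  · intro h i
    have h' : ∀ i : Fin t, x i ω = a i := congrFun h
    rw [← h' i, hg i ω, hdata i fun j => h' (Fin.castLE i.2.le j)]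
  · intro h
    have key : ∀ n (hn : n < t), x n ω = a ⟨n, hn⟩ := by
      intro n
      induction n using Nat.strong_induction_on with
      | _ n ih =>
        intro hn
        rw [hg n ω, hdata ⟨n, hn⟩ fun j => ih j j.2 _]
        exact h ⟨n, hn⟩
    exact funext fun i => key i i.2

lemma measurable_query [MeasurableSpace Ω] [Countable 𝒳] [MeasurableSpace 𝒳]
    [DiscreteMeasurableSpace 𝒳] [MeasurableSpace 𝒰] {g : ∀ t : ℕ, 𝒰 × (Fin t → 𝒳 × ℝ) × ℝ → 𝒳}
    (hgm : ∀ t, Measurable (g t)) (hg : ∀ t ω, x t ω = g t (U ω, dataset f ε x t ω, ζ t ω))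
    (hf : ∀ x, Measurable (f x)) (hε : ∀ t, Measurable (ε t)) (hζ : ∀ t, Measurable (ζ t))
    (hU : Measurable U) (t : ℕ) : Measurable (x t) := by
  induction t using Nat.strong_induction_on with
  | _ t ih =>
    rw [show x t = fun ω => g t (U ω, dataset f ε x t ω, ζ t ω) from funext (hg t)]
    refine (hgm t).comp (hU.prodMk (Measurable.prodMk ?_ (hζ t)))
    exact measurable_pi_lambda _ fun i => (ih i i.2).prodMk
      ((measurable_apply_of_finite hf (ih i i.2)).add (hε i))

end

/-- The exogenous randomness of the algorithm: confidence parameters `ζ` with the two-parameter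
exponential law and tie-breaking variable `U`, independent of each other and of `(f, ε)`. -/
structure IsExogenous {Ω 𝒳 𝒰 : Type*} [MeasurableSpace Ω] [MeasurableSpace 𝒰] (P : Measure Ω)
    (s : ℝ) (f : 𝒳 → Ω → ℝ) (ε ζ : ℕ → Ω → ℝ) (U : Ω → 𝒰) : Prop where
  meas : ∀ t, Measurable (ζ t)
  law : ∀ t, HasLaw (ζ t) (twoParamExpMeasure s (1 / 2)) P
  indep : iIndepFun ζ P
  meas_tie : Measurable U
  indep_params : IndepFun (fun ω => ((fun x => f x ω), (fun t => ε t ω))) (fun ω t => ζ t ω) P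
  indep_tie : IndepFun (fun ω => ((fun x => f x ω), (fun t => ε t ω), (fun t => ζ t ω))) U P

namespace IsExogenous

variable {Ω 𝒳 𝒰 : Type*} [MeasurableSpace Ω] [MeasurableSpace 𝒰] {P : Measure Ω} {s : ℝ}
  {f : 𝒳 → Ω → ℝ} {ε ζ : ℕ → Ω → ℝ} {U : Ω → 𝒰}

lemma integrable (hz : IsExogenous P s f ε ζ U) (t : ℕ) : Integrable (ζ t) P := by
  have h := (integrable_id_twoParamExpMeasure s (l := 1 / 2) (by norm_num)).1
  rw [← (hz.law t).map_eq] at h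
  exact h.comp_measurable (hz.meas t)

lemma integral_eq (hz : IsExogenous P s f ε ζ U) (t : ℕ) : ∫ ω, ζ t ω ∂P = 2 + s := by
  rw [(hz.law t).integral_eq,
    (integrable_id_twoParamExpMeasure s (l := 1 / 2) (by norm_num)).2]
  norm_num
  ring

lemma nonneg (hz : IsExogenous P s f ε ζ U) (hs : 0 ≤ s) (t : ℕ) : ∀ᵐ ω ∂P, 0 ≤ ζ t ω := by
  have h := ae_le_twoParamExpMeasure s (l := 1 / 2) (by norm_num)
  rw [← (hz.law t).map_eq] at h
  filter_upwards [ae_of_ae_map (hz.meas t).aemeasurable h] with ω hω using hs.trans hω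

variable [IsProbabilityMeasure P] [Fintype 𝒳] {k : 𝒳 → 𝒳 → ℝ} {v : ℝ≥0}

/-- At fixed query points, the observations, the past confidence parameters and the tie-breaking
variable are independent of the current confidence parameter and of the error of the posterior
mean. -/
lemma indepFun_past (hz : IsExogenous P s f ε ζ U) (h : IsGPRegression P k v f ε) {t : ℕ}
    (a : Fin t → 𝒳) :
    IndepFun (fun ω => ((noisyObs f ε a ω, fun i : Fin t => ζ i ω), U ω))
      (fun ω => ((fun y => postResid k v f ε a y ω), ζ t ω)) P := by
  have hO := h.measurable_noisyObs a
  have hR : Measurable fun ω y => postResid k v f ε a y ω :=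
    measurable_pi_lambda _ fun y => h.measurable_postResid a y
  have hZ : Measurable fun ω (i : Fin t) => ζ i ω := measurable_pi_lambda _ fun i => hz.meas i
  have hZind : IndepFun (fun ω (i : Fin t) => ζ i ω) (ζ t) P := by
    have := hz.indep.indepFun_finset (Finset.range t) {t} (by simp) hz.meas
    exact this.comp (φ := fun (u : ↥(Finset.range t) → ℝ) (j : Fin t) => u ⟨j, by simp⟩)
      (ψ := fun u : (↥({t} : Finset ℕ) → ℝ) => u ⟨t, by simp⟩) (by fun_prop) (by fun_prop)
  -- Observations and errors as functions of the values of the process and the noise.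
  let obs : (𝒳 → ℝ) × (ℕ → ℝ) → Fin t → ℝ := fun p i => p.1 (a i) + p.2 i
  let res : (𝒳 → ℝ) × (ℕ → ℝ) → 𝒳 → ℝ := fun p y =>
    p.1 y - ∑ i, postWeight k v a y i * obs p i
  have hobs : Measurable obs := by fun_prop
  have hres : Measurable res := by fun_prop
  have h1 := indepFun_prodMk_prodMk_comm hO hR hZ (hz.meas t)
    (h.indepFun_postResid_noisyObs a).symm hZind
    (hz.indep_params.comp (φ := fun p => (obs p, res p))
      (ψ := fun u : ℕ → ℝ => ((fun i : Fin t => u i), u t)) (by fun_prop) (by fun_prop))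
  have h2 : IndepFun (fun ω => (((fun y => postResid k v f ε a y ω), ζ t ω),
      (noisyObs f ε a ω, fun i : Fin t => ζ i ω))) U P :=
    hz.indep_tie.comp (φ := fun p : (𝒳 → ℝ) × (ℕ → ℝ) × (ℕ → ℝ) =>
      ((res (p.1, p.2.1), p.2.2 t), (obs (p.1, p.2.1), fun i : Fin t => p.2.2 i)))
      (by fun_prop) measurable_id
  exact (indepFun_prodMk_right_of_prodMk_left (hR.prodMk (hz.meas t)) (hO.prodMk hZ) hz.meas_tie
    h1.symm h2).symm

/-- At fixed query points, the error of the posterior mean is independent of everything that the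
algorithm uses in round `t`. -/
lemma indepFun_postResid (hz : IsExogenous P s f ε ζ U) (h : IsGPRegression P k v f ε) {t : ℕ}
    (a : Fin t → 𝒳) :
    IndepFun (fun ω => (((noisyObs f ε a ω, fun i : Fin t => ζ i ω), U ω), ζ t ω))
      (fun ω y => postResid k v f ε a y ω) P := by
  have hR : Measurable fun ω y => postResid k v f ε a y ω :=
    measurable_pi_lambda _ fun y => h.measurable_postResid a y
  have hW : Measurable fun ω => ((noisyObs f ε a ω, fun i : Fin t => ζ i ω), U ω) :=
    ((h.measurable_noisyObs a).prodMk (measurable_pi_lambda _ fun i : Fin t => hz.meas i)).prodMk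
      hz.meas_tie
  have hζR : IndepFun (ζ t) (fun ω y => postResid k v f ε a y ω) P := by
    have hres : Measurable fun (p : (𝒳 → ℝ) × (ℕ → ℝ)) (y : 𝒳) =>
        p.1 y - ∑ i, postWeight k v a y i * (p.1 (a i) + p.2 i) := by fun_prop
    exact (hz.indep_params.comp hres (measurable_pi_apply t)).symm
  exact indepFun_prodMk_left_of_prodMk_right hW (hz.meas t) hR hζR
    ((hz.indepFun_past h a).comp measurable_id measurable_swap)

end IsExogenous

/-! ### Regret of the randomised upper confidence bound rule -/

lemma measurable_firstQueries {Ω 𝒳 : Type*} [MeasurableSpace Ω] [MeasurableSpace 𝒳]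
    {x : ℕ → Ω → 𝒳} (hx : ∀ t, Measurable (x t)) (t : ℕ) : Measurable (firstQueries x t) :=
  measurable_pi_lambda _ fun i => hx i

namespace IsGPRegression

variable {Ω 𝒳 𝒰 : Type*} [MeasurableSpace Ω] {P : Measure Ω} [MeasurableSpace 𝒰]
  {k : 𝒳 → 𝒳 → ℝ} {v : ℝ≥0} {f : 𝒳 → Ω → ℝ} {ε ζ : ℕ → Ω → ℝ} {U : Ω → 𝒰} {x : ℕ → Ω → 𝒳} {s : ℝ}

lemma query_measurable [Fintype 𝒳] [MeasurableSpace 𝒳]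
    [DiscreteMeasurableSpace 𝒳] (h : IsGPRegression P k v f ε) (hz : IsExogenous P s f ε ζ U)
    (hx : IsRandomizedGPUCB k v f ε ζ U x) (t : ℕ) : Measurable (x t) := by
  obtain ⟨g, hgm, hg⟩ := hx.rule
  exact measurable_query hgm hg h.process.measurable h.noise_meas hz.meas hz.meas_tie t

variable [IsProbabilityMeasure P]

lemma integrable_process (h : IsGPRegression P k v f ε) (y : 𝒳) : Integrable (f y) P :=
  (h.memLp_process y).integrable one_le_two

lemma integrable_postResid (h : IsGPRegression P k v f ε) {t : ℕ} (a : Fin t → 𝒳) (y : 𝒳) :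
    Integrable (postResid k v f ε a y) P :=
  (h.memLp_postResid a y).integrable one_le_two

lemma integrable_postMean (h : IsGPRegression P k v f ε) {t : ℕ} (a : Fin t → 𝒳) (y : 𝒳) :
    Integrable (fun ω => postMean k v (dataOf a (noisyObs f ε a ω)) y) P := by
  simp only [postMean_eq_sum]
  exact (h.memLp_weightedObs a y).integrable one_le_two

variable [Fintype 𝒳] [MeasurableSpace 𝒳] [DiscreteMeasurableSpace 𝒳]

/-- The expected posterior mean at the adaptively chosen query does not exceed the expected value
of the process there: on each event fixing the queries, the error of the posterior mean is centred
and independent of the event. -/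
theorem integral_postMean_sub_process_nonpos (h : IsGPRegression P k v f ε)
    (hz : IsExogenous P s f ε ζ U) (hx : IsRandomizedGPUCB k v f ε ζ U x) (t : ℕ) :
    Integrable (fun ω => postMean k v (dataset f ε x t ω) (x t ω) - f (x t ω) ω) P ∧
    ∫ ω, (postMean k v (dataset f ε x t ω) (x t ω) - f (x t ω) ω) ∂P ≤ 0 := by
  obtain ⟨g, hgm, hg⟩ := hx.rule
  have hxm := h.query_measurable hz hx
  have hX : Measurable fun ω => (firstQueries x t ω, x t ω) :=
    (measurable_firstQueries hxm t).prodMk (hxm t)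
  have heq : ∀ ω, postMean k v (dataset f ε x t ω) (x t ω) - f (x t ω) ω =
      (fun (p : (Fin t → 𝒳) × 𝒳) ω => -postResid k v f ε p.1 p.2 ω)
        (firstQueries x t ω, x t ω) ω := fun ω => by
    simp only
    rw [← postMean_add_postResid k v f ε (firstQueries x t ω) (x t ω) ω, dataset_eq_dataOf]
    ring
  have hint : ∀ p : (Fin t → 𝒳) × 𝒳, Integrable (fun ω => -postResid k v f ε p.1 p.2 ω) P :=
    fun p => (h.integrable_postResid p.1 p.2).neg
  simp only [heq]
  refine ⟨integrable_apply_of_fintype hint hX, integral_apply_nonpos hint hX fun p => ?_⟩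
  obtain ⟨a, y⟩ := p
  -- The event that the first queries are `a` and the next one is `y`, in terms of the observations
  -- at the fixed points `a` and the exogenous randomness.
  let B : Set ((((Fin t → ℝ) × (Fin t → ℝ)) × 𝒰) × ℝ) :=
    {w | w.1 ∈ queryEvent g a} ∩ {w | g t (w.1.2, dataOf a w.1.1.1, w.2) = y}
  have hB : MeasurableSet B := by
    refine (measurable_fst (measurableSet_queryEvent hgm a)).inter ?_
    exact ((hgm t).comp ((by fun_prop : Measurable fun w : (((Fin t → ℝ) × (Fin t → ℝ)) × 𝒰) × ℝ =>
      w.1.2).prodMk (((measurable_dataOf a).comp (by fun_prop)).prodMk measurable_snd)))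
      (measurableSet_singleton y)
  have hΦ : Measurable fun q : ((((Fin t → ℝ) × (Fin t → ℝ)) × 𝒰) × ℝ) × (𝒳 → ℝ) =>
      B.indicator (fun _ => (1 : ℝ)) q.1 * -q.2 y :=
    ((measurable_const.indicator hB).comp measurable_fst).mul
      (((measurable_pi_apply y).comp measurable_snd).neg)
  have hev : ∀ ω, ((fun ω => (firstQueries x t ω, x t ω)) ⁻¹' {(a, y)}).indicator
      (fun ω => -postResid k v f ε a y ω) ω =
      B.indicator (fun _ => (1 : ℝ)) (((noisyObs f ε a ω, fun i : Fin t => ζ i ω), U ω), ζ t ω) *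
        -postResid k v f ε a y ω := by
    intro ω
    have hmem : ω ∈ (fun ω => (firstQueries x t ω, x t ω)) ⁻¹' {(a, y)} ↔
        (((noisyObs f ε a ω, fun i : Fin t => ζ i ω), U ω), ζ t ω) ∈ B := by
      rw [Set.mem_preimage, Set.mem_singleton_iff, Prod.mk.injEq]
      constructor
      · rintro ⟨h1, h2⟩
        refine ⟨(firstQueries_eq_iff hg a ω).1 h1, ?_⟩
        rw [hg t ω, dataset_eq_dataOf, h1] at h2
        exact h2
      · rintro ⟨h1, h2⟩
        have h1' := (firstQueries_eq_iff hg a ω).2 h1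
        refine ⟨h1', ?_⟩
        rw [hg t ω, dataset_eq_dataOf, h1']
        exact h2
    by_cases hω : ω ∈ (fun ω => (firstQueries x t ω, x t ω)) ⁻¹' {(a, y)}
    · rw [Set.indicator_of_mem hω, Set.indicator_of_mem (hmem.1 hω), one_mul]
    · rw [Set.indicator_of_notMem hω, Set.indicator_of_notMem (fun hc => hω (hmem.2 hc)), zero_mul]
  have hi := ((hint (a, y)).indicator (hX (measurableSet_singleton (a, y)))).congr
    (ae_of_all _ hev)
  simp only [hev]
  refine integral_nonpos_of_indepFun
    (W := fun ω => (((noisyObs f ε a ω, fun i : Fin t => ζ i ω), U ω), ζ t ω))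
    (V := fun ω y => postResid k v f ε a y ω) ?_ ?_ (hz.indepFun_postResid h a) hΦ hi fun w => ?_
  · exact (((h.measurable_noisyObs a).prodMk (measurable_pi_lambda _ fun i : Fin t =>
      hz.meas i)).prodMk hz.meas_tie).prodMk (hz.meas t)
  · exact measurable_pi_lambda _ fun y => h.measurable_postResid a y
  · simp only
    rw [integral_const_mul, integral_neg, h.integral_postResid, neg_zero, mul_zero]

variable [Nonempty 𝒳]

/-- The expected maximum of the process is at most the expected maximum of the acquisition
function. -/
theorem integral_max_sub_ucb_nonpos (h : IsGPRegression P k v f ε)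
    (hz : IsExogenous P s f ε ζ U) (hx : IsRandomizedGPUCB k v f ε ζ U x)
    (hs : s = 2 * Real.log ((Fintype.card 𝒳 : ℝ) / 2)) (hcard : 2 ≤ Fintype.card 𝒳) (t : ℕ) :
    Integrable (fun ω => (⨆ y, f y ω) - ⨆ y, ucb k v (dataset f ε x t ω) (ζ t ω) y) P ∧
    ∫ ω, ((⨆ y, f y ω) - ⨆ y, ucb k v (dataset f ε x t ω) (ζ t ω) y) ∂P ≤ 0 := by
  obtain ⟨g, hgm, hg⟩ := hx.rule
  have hX := measurable_firstQueries (h.query_measurable hz hx) t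
  have hsqrt := integrable_sqrt_of_integrable (hz.integrable t)
  have hint : ∀ a : Fin t → 𝒳, Integrable (fun ω =>
      (⨆ y, f y ω) - ⨆ y, ucb k v (dataOf a (noisyObs f ε a ω)) (ζ t ω) y) P := fun a => by
    refine (integrable_ciSup_of_fintype h.integrable_process).sub
      (integrable_ciSup_of_fintype fun y => ?_)
    simp only [ucb, postVar_eq_designVar]
    exact (h.integrable_postMean a y).add (hsqrt.mul_const (√(designVar k v a y)))
  simp only [dataset_eq_dataOf]
  refine ⟨integrable_apply_of_fintype (g := fun a ω =>
      (⨆ y, f y ω) - ⨆ y, ucb k v (dataOf a (noisyObs f ε a ω)) (ζ t ω) y) hint hX,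
    integral_apply_nonpos (g := fun a ω =>
      (⨆ y, f y ω) - ⨆ y, ucb k v (dataOf a (noisyObs f ε a ω)) (ζ t ω) y) hint hX fun a => ?_⟩
  -- For given past data `w`, the process is the posterior mean plus an independent error.
  let Ψ : (((Fin t → ℝ) × (Fin t → ℝ)) × 𝒰) × ((𝒳 → ℝ) × ℝ) → ℝ := fun q =>
    (⨆ y, (postMean k v (dataOf a q.1.1.1) y + q.2.1 y)) -
      ⨆ y, (postMean k v (dataOf a q.1.1.1) y + √q.2.2 * √(designVar k v a y))
  have hΨ : Measurable Ψ := by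
    have hm : ∀ y, Measurable fun q : (((Fin t → ℝ) × (Fin t → ℝ)) × 𝒰) × ((𝒳 → ℝ) × ℝ) =>
        postMean k v (dataOf a q.1.1.1) y := fun y =>
      (measurable_postMean_dataOf k v a y).comp (by fun_prop)
    refine (Measurable.iSup fun y => (hm y).add (by fun_prop)).sub
      (Measurable.iSup fun y => (hm y).add (by fun_prop))
  have hΦ : Measurable fun q : (((Fin t → ℝ) × (Fin t → ℝ)) × 𝒰) × ((𝒳 → ℝ) × ℝ) =>
      (queryEvent g a).indicator (fun _ => (1 : ℝ)) q.1 * Ψ q :=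
    ((measurable_const.indicator (measurableSet_queryEvent hgm a)).comp measurable_fst).mul hΨ
  have hev : ∀ ω, (firstQueries x t ⁻¹' {a}).indicator (fun ω =>
      (⨆ y, f y ω) - ⨆ y, ucb k v (dataOf a (noisyObs f ε a ω)) (ζ t ω) y) ω =
      (queryEvent g a).indicator (fun _ => (1 : ℝ))
        ((noisyObs f ε a ω, fun i : Fin t => ζ i ω), U ω) *
        Ψ (((noisyObs f ε a ω, fun i : Fin t => ζ i ω), U ω),
          ((fun y => postResid k v f ε a y ω), ζ t ω)) := by
    intro ω
    have hmem : ω ∈ firstQueries x t ⁻¹' {a} ↔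
        ((noisyObs f ε a ω, fun i : Fin t => ζ i ω), U ω) ∈ queryEvent g a :=
      firstQueries_eq_iff hg a ω
    have hval : (⨆ y, f y ω) - ⨆ y, ucb k v (dataOf a (noisyObs f ε a ω)) (ζ t ω) y =
        Ψ (((noisyObs f ε a ω, fun i : Fin t => ζ i ω), U ω),
          ((fun y => postResid k v f ε a y ω), ζ t ω)) := by
      simp only [Ψ, postMean_add_postResid, ucb, postVar_eq_designVar]
      rfl
    by_cases hω : ω ∈ firstQueries x t ⁻¹' {a}
    · rw [Set.indicator_of_mem hω, Set.indicator_of_mem (hmem.1 hω), one_mul, hval]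
    · rw [Set.indicator_of_notMem hω, Set.indicator_of_notMem (fun hc => hω (hmem.2 hc)), zero_mul]
  have hi := ((hint a).indicator (hX (measurableSet_singleton a))).congr (ae_of_all _ hev)
  simp only [hev]
  refine integral_nonpos_of_indepFun
    (W := fun ω => ((noisyObs f ε a ω, fun i : Fin t => ζ i ω), U ω))
    (V := fun ω => ((fun y => postResid k v f ε a y ω), ζ t ω)) ?_ ?_
    (hz.indepFun_past h a) hΦ hi fun w => ?_
  · exact ((h.measurable_noisyObs a).prodMk (measurable_pi_lambda _ fun i : Fin t =>
      hz.meas i)).prodMk hz.meas_tie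
  · exact (measurable_pi_lambda _ fun y => h.measurable_postResid a y).prodMk (hz.meas t)
  · simp only
    rw [integral_const_mul]
    refine mul_nonpos_of_nonneg_of_nonpos (Set.indicator_nonneg (fun _ _ => zero_le_one) _) ?_
    have hle := integral_max_gaussian_le_integral_ucb (μ := P) hcard
      (fun y => postMean k v (dataOf a w.1.1) y) (fun y => (designVar k v a y).toNNReal)
      (fun y => postResid k v f ε a y) (h.measurable_postResid a) (h.map_postResid a)
    simp only [Real.coe_toNNReal _ (h.designVar_nonneg a _)] at hle
    have hmζ : Measurable fun z : ℝ =>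
        ⨆ y, (postMean k v (dataOf a w.1.1) y + √z * √(designVar k v a y)) :=
      Measurable.iSup fun y => by fun_prop
    rw [← hs, ← (hz.law t).map_eq, integral_map (hz.meas t).aemeasurable
      hmζ.aestronglyMeasurable] at hle
    have hi1 : Integrable (fun ω => ⨆ y, (postMean k v (dataOf a w.1.1) y +
        postResid k v f ε a y ω)) P := integrable_ciSup_of_fintype fun y =>
      (integrable_const _).add (h.integrable_postResid a y)
    have hi2 : Integrable (fun ω => ⨆ y, (postMean k v (dataOf a w.1.1) y +
        √(ζ t ω) * √(designVar k v a y))) P := integrable_ciSup_of_fintype fun y =>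
      (integrable_const _).add (hsqrt.mul_const _)
    simp only [Ψ]
    rw [integral_sub hi1 hi2]
    exact sub_nonpos.2 hle

/-- The expected regret of a round is at most the expected width `√ζ σ(x)` of the confidence bound
at the query. -/
theorem integral_regret_le (h : IsGPRegression P k v f ε)
    (hz : IsExogenous P s f ε ζ U) (hx : IsRandomizedGPUCB k v f ε ζ U x)
    (hs : s = 2 * Real.log ((Fintype.card 𝒳 : ℝ) / 2)) (hcard : 2 ≤ Fintype.card 𝒳) (t : ℕ) :
    Integrable (fun ω => √(ζ t ω) * √(designVar k v (firstQueries x t ω) (x t ω))) P ∧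
    ∫ ω, ((⨆ y, f y ω) - f (x t ω) ω) ∂P ≤
      ∫ ω, √(ζ t ω) * √(designVar k v (firstQueries x t ω) (x t ω)) ∂P := by
  have h1 := h.integral_max_sub_ucb_nonpos hz hx hs hcard t
  have h2 := h.integral_postMean_sub_process_nonpos hz hx t
  have hxm := h.query_measurable hz hx
  have hX : Measurable fun ω => (firstQueries x t ω, x t ω) :=
    (measurable_firstQueries hxm t).prodMk (hxm t)
  have hw : Integrable (fun ω => √(ζ t ω) * √(designVar k v (firstQueries x t ω) (x t ω))) P :=
    integrable_apply_of_fintype (g := fun (p : (Fin t → 𝒳) × 𝒳) ω =>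
      √(ζ t ω) * √(designVar k v p.1 p.2))
      (fun p => (integrable_sqrt_of_integrable (hz.integrable t)).mul_const _) hX
  refine ⟨hw, ?_⟩
  have hdecomp : ∀ ω, (⨆ y, f y ω) - f (x t ω) ω =
      ((⨆ y, f y ω) - ⨆ y, ucb k v (dataset f ε x t ω) (ζ t ω) y) +
      ((postMean k v (dataset f ε x t ω) (x t ω) - f (x t ω) ω) +
        √(ζ t ω) * √(designVar k v (firstQueries x t ω) (x t ω))) := by
    intro ω
    have hmax : ⨆ y, ucb k v (dataset f ε x t ω) (ζ t ω) y =
        ucb k v (dataset f ε x t ω) (ζ t ω) (x t ω) :=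
      le_antisymm (ciSup_le (hx.argmax t ω)) (le_ciSup (Set.finite_range _).bddAbove (x t ω))
    rw [hmax, ucb, postVar_eq_designVar]
    simp only [dataset_eq_dataOf, dataOf]
    ring
  simp only [hdecomp]
  rw [integral_add h1.1 (by exact h2.1.add hw), integral_add h2.1 hw]
  linarith [h1.2, h2.2]

lemma integrable_regret (h : IsGPRegression P k v f ε) (hz : IsExogenous P s f ε ζ U)
    (hx : IsRandomizedGPUCB k v f ε ζ U x) (t : ℕ) :
    Integrable (fun ω => (⨆ y, f y ω) - f (x t ω) ω) P :=
  (integrable_ciSup_of_fintype h.integrable_process).sub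
    (integrable_apply_of_fintype h.integrable_process (h.query_measurable hz hx t))

/-- The regret bound for at least two points, by Cauchy–Schwarz over the rounds and Jensen's
inequality for the square root. -/
theorem bayesCumRegret_le (h : IsGPRegression P k v f ε)
    (hz : IsExogenous P s f ε ζ U) (hx : IsRandomizedGPUCB k v f ε ζ U x)
    (hs : s = 2 * Real.log ((Fintype.card 𝒳 : ℝ) / 2)) (hcard : 2 ≤ Fintype.card 𝒳) (T : ℕ) :
    bayesCumRegret P f x T ≤
      √(2 / Real.log (1 + (v : ℝ)⁻¹) * (2 + s) * T * (maxInfoGain P f ε T).toReal) := by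
  have hs0 : 0 ≤ s := by
    have : (2 : ℝ) ≤ Fintype.card 𝒳 := by exact_mod_cast hcard
    rw [hs]
    exact mul_nonneg zero_le_two (Real.log_nonneg (by linarith))
  set G : ℝ := 2 / Real.log (1 + (v : ℝ)⁻¹) * (maxInfoGain P f ε T).toReal with hG
  have hround := h.integral_regret_le hz hx hs hcard
  have hZint : Integrable (fun ω => ∑ t ∈ Finset.range T, ζ t ω) P :=
    integrable_finsetSum _ fun t _ => hz.integrable t
  have hZnn : 0 ≤ᵐ[P] fun ω => ∑ t ∈ Finset.range T, ζ t ω := by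
    filter_upwards [ae_all_iff.2 (hz.nonneg hs0)] with ω hω
    exact Finset.sum_nonneg fun t _ => hω t
  have hZ : ∫ ω, ∑ t ∈ Finset.range T, ζ t ω ∂P = T * (2 + s) := by
    rw [integral_finsetSum _ fun t _ => hz.integrable t]
    simp only [hz.integral_eq, Finset.sum_const, Finset.card_range, nsmul_eq_mul]
  calc bayesCumRegret P f x T
      = ∑ t ∈ Finset.range T, ∫ ω, ((⨆ y, f y ω) - f (x t ω) ω) ∂P :=
        integral_finsetSum _ fun t _ => h.integrable_regret hz hx t
    _ ≤ ∑ t ∈ Finset.range T,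
          ∫ ω, √(ζ t ω) * √(designVar k v (firstQueries x t ω) (x t ω)) ∂P :=
        Finset.sum_le_sum fun t _ => (hround t).2
    _ = ∫ ω, ∑ t ∈ Finset.range T,
          √(ζ t ω) * √(designVar k v (firstQueries x t ω) (x t ω)) ∂P :=
        (integral_finsetSum _ fun t _ => (hround t).1).symm
    _ ≤ ∫ ω, √(∑ t ∈ Finset.range T, ζ t ω) * √G ∂P := by
        refine integral_mono_ae (integrable_finsetSum _ fun t _ => (hround t).1)
          ((integrable_sqrt_of_integrable hZint).mul_const _) ?_
        filter_upwards [ae_all_iff.2 (hz.nonneg hs0)] with ω hω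
        -- Cauchy–Schwarz over the rounds, for a fixed outcome.
        refine (Real.sum_sqrt_mul_sqrt_le _ hω fun t =>
          h.designVar_nonneg (firstQueries x t ω) (x t ω)).trans ?_
        gcongr
        exact h.sum_designVar_le (fun t => x t ω) T
    _ = (∫ ω, √(∑ t ∈ Finset.range T, ζ t ω) ∂P) * √G := integral_mul_const _ _
    _ ≤ √(T * (2 + s)) * √G := by
        gcongr
        exact (integral_sqrt_le_sqrt_integral hZint hZnn).trans_eq (by rw [hZ])
    _ = √(2 / Real.log (1 + (v : ℝ)⁻¹) * (2 + s) * T * (maxInfoGain P f ε T).toReal) := by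
        rw [← Real.sqrt_mul (by positivity), hG]
        congr 1
        ring

end IsGPRegression

theorem theorem3
    {Ω : Type*} [MeasurableSpace Ω] (P : Measure Ω) [IsProbabilityMeasure P]
    -- finite input domain
    {𝒳 : Type*} [Fintype 𝒳] [Nonempty 𝒳] [MeasurableSpace 𝒳] [DiscreteMeasurableSpace 𝒳]
    -- objective function `f ∼ GP(0, k)` with `k(x, x) = 1`
    (k : 𝒳 → 𝒳 → ℝ) (hk : ∀ x, k x x = 1)
    (f : 𝒳 → Ω → ℝ) (hf : IsCenteredGP P k f)
    -- i.i.d. Gaussian observation noise with positive variance `σ ^ 2`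
    (σ : ℝ≥0) (hσ : 0 < σ)
    (ε : ℕ → Ω → ℝ) (hε_meas : ∀ t, Measurable (ε t))
    (hε_law : ∀ t, HasLaw (ε t) (gaussianReal 0 (σ ^ 2)) P) (hε_indep : iIndepFun ε P)
    -- i.i.d. two-parameter exponential confidence parameters
    (s : ℝ) (hs : s = 2 * Real.log ((Fintype.card 𝒳 : ℝ) / 2))
    (ζ : ℕ → Ω → ℝ) (hζ_meas : ∀ t, Measurable (ζ t))
    (hζ_law : ∀ t, HasLaw (ζ t) (twoParamExpMeasure s (1 / 2)) P) (hζ_indep : iIndepFun ζ P)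
    -- auxiliary randomness for breaking ties
    {𝒰 : Type*} [MeasurableSpace 𝒰] (U : Ω → 𝒰) (hU_meas : Measurable U)
    -- `f`, the noise, the confidence parameters and `U` are mutually independent
    (hfε : IndepFun (fun ω x => f x ω) (fun ω t => ε t ω) P)
    (hfεζ : IndepFun (fun ω => ((fun x => f x ω), (fun t => ε t ω))) (fun ω t => ζ t ω) P)
    (hfεζU : IndepFun
      (fun ω => ((fun x => f x ω), (fun t => ε t ω), (fun t => ζ t ω))) U P)
    -- the queries made by the algorithm
    (x : ℕ → Ω → 𝒳) (hx : IsRandomizedGPUCB k ((σ : ℝ) ^ 2) f ε ζ U x)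
    (T : ℕ) (C₁ C₂ : ℝ) (hC₁ : C₁ = 2 / Real.log (1 + ((σ : ℝ) ^ 2)⁻¹)) (hC₂ : C₂ = 2 + s) :
    maxInfoGain P f ε T ≠ ∞ ∧
    Integrable (cumRegret f x T) P ∧
    bayesCumRegret P f x T ≤ √(C₁ * C₂ * T * (maxInfoGain P f ε T).toReal) := by
  have h : IsGPRegression P k (σ ^ 2) f ε :=
    ⟨hk, hf, by positivity, hε_meas, hε_law, hε_indep, hfε⟩
  have hz : IsExogenous P s f ε ζ U := ⟨hζ_meas, hζ_law, hζ_indep, hU_meas, hfεζ, hfεζU⟩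
  have hcoe : (σ : ℝ) ^ 2 = ((σ ^ 2 : ℝ≥0) : ℝ) := by push_cast; rfl
  rw [hcoe] at hx hC₁
  refine ⟨h.maxInfoGain_ne_top T, integrable_finsetSum _ fun t _ => h.integrable_regret hz hx t, ?_⟩
  by_cases hcard : 2 ≤ Fintype.card 𝒳
  · rw [hC₁, hC₂]
    exact h.bayesCumRegret_le hz hx hs hcard T
  · -- With a single point there is no regret.
    have hsub : Subsingleton 𝒳 := Fintype.card_le_one_iff_subsingleton.1 (by omega)
    have hzero : bayesCumRegret P f x T = 0 := by
      have : ∀ ω, cumRegret f x T ω = 0 := fun ω => Finset.sum_eq_zero fun t _ => by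
        rw [ciSup_subsingleton (x t ω) fun y => f y ω, sub_self]
      simp [bayesCumRegret, this]
    rw [hzero]
    exact Real.sqrt_nonneg _
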